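/- Let $p,q,r>0$ with $p+q+r=1$, and let $p',r',q'',r''>0$ satisfy $p'+r'=q''+r''=1$, $p/r=p'/r'$ and $q/r=q''/r''$. Consider the Markov chain on $\mathbb{N}^2$ started at $(0,0)$, with the following transitions. From $(i,j)$ with $i,j>0$ it moves to $(i-1,j)$, $(i,j-1)$, $(i+1,j+1)$ with respective probabilities $p,q,r$. From $(i,0)$ with $i>0$ it moves to $(i-1,0)$, $(i+1,1)$ with probabilities $p',r'$. From $(0,j)$ with $j>0$ it moves to $(0,j-1)$, $(1,j+1)$ with probabilities $q'',r''$. From $(0,0)$ it moves to $(1,1)$ with probability $1$. Let $p_{i,j}(n)$ be the probability that the chain is at $(i,j)$ at time $n$, and define the formal power series $$P_{0,0}=\sum_{n} p_{0,0}(n)t^n,\quad P_1(x)=\sum_{n}\sum_{i>0}p_{i,0}(n)x^it^n,\quad P_2(y)=\sum_{n}\sum_{j>0}p_{0,j}(n)y^jt^n,$$ $$P(x,y)=\sum_{n}\sum_{i,j>0}p_{i,j}(n)x^iy^jt^n,\quad Q(x,y)=P_{0,0}+r'P_1(x)+r''P_2(y)+rP(x,y),\quad F(x,y)=\sum_{n,i,j\ge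 0}p_{i,j}(n)x^iy^jt^n.$$ **Theorem (the symmetric case).** Assume $p=q$. Then: 1. The series $F$ is algebraic over $\mathbb{R}(x,y,t)$. 2. We have $p_{0,0}(n)=0$ unless $3\mid n$, and $P_{0,0}=\sum_{n}p_{0,0}(3n)t^{3n}$ is algebraic of degree $6$ over $\mathbb{R}(t)$. 3. There is a unique power series $Z\in\mathbb{R}[[t]]$ such that $Z=1+4pqr\,t^3Z^3$. Put $\Delta_+(x)=1-4pqr\,t^2Z^2x$ and $\Delta_-(u)=1-tZ(1+Z)u+t^2Z^2u^2$, so that $\Delta_-(p/t)=1-pZ(1+Z)+p^2Z^2$. These two series $\Delta_+(x)$ and $\Delta_-(p/t)$ have power series square roots with positive constant term, and with these square roots $$P_{0,0}=\frac rp\left(\frac{\sqrt{\Delta_-(p/t)}}{1-2pZ}-1\right),$$ $$\bigl(t-x(1-p)+prx^2t^2\bigr)\,Q(px,0)=\frac r{2p}\left(\frac{(2tZ-x)\sqrt{\Delta_-(p/t)}\sqrt{\Delta_+(x)}}{Z(1-2pZ)}-2t+x(1-p)\right),$$ where $Q(px,0)=P_{0,0}+r'P_1(px)$. Setting $x=0$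 in $Q(px,0)$ gives $P_{0,0}$. 4. The whole generating function is then given explicitly in terms of $Z$: $Q(0,py)$ is obtained from $Q(px,0)$ by replacing $x$ by $y$, $$\bigl(xy-t(x+y+pqrx^2y^2)\bigr)Q(px,py)=rxy-(t-py)x\,Q(px,0)-(t-px)y\,Q(0,py),$$ and $$F(px,py)=P_{0,0}+\frac{Q(px,0)-P_{0,0}}{r'}+\frac{Q(0,py)-P_{0,0}}{r''}+\frac{Q(px,py)-Q(px,0)-Q(0,py)+P_{0,0}}{r}.$$ -/

import Mathlib

open scoped RatFunc

/-- The parameters of the random walk in the quadrant: positive transition probabilities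
`p, q, r` in the interior, `p₁, r₁` on the positive horizontal axis and `q₂, r₂` on the
positive vertical axis. -/
structure QuadrantWalk where
  p : ℝ
  q : ℝ
  r : ℝ
  p₁ : ℝ
  r₁ : ℝ
  q₂ : ℝ
  r₂ : ℝ
  p_pos : 0 < p
  q_pos : 0 < q
  r_pos : 0 < r
  p₁_pos : 0 < p₁
  r₁_pos : 0 < r₁
  q₂_pos : 0 < q₂
  r₂_pos : 0 < r₂
  sum_interior : p + q + r = 1
  sum_horizontal : p₁ + r₁ = 1
  sum_vertical : q₂ + r₂ = 1

/-- The variable `x` of the trivariate power series in `x, y, t`. -/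
noncomputable abbrev xVar : MvPowerSeries (Fin 3) ℝ := MvPowerSeries.X 0

/-- The variable `y`. -/
noncomputable abbrev yVar : MvPowerSeries (Fin 3) ℝ := MvPowerSeries.X 1

/-- The variable `t`. -/
noncomputable abbrev tVar : MvPowerSeries (Fin 3) ℝ := MvPowerSeries.X 2

/-- A real constant, as a power series in `x, y, t`. -/
noncomputable abbrev const3 (c : ℝ) : MvPowerSeries (Fin 3) ℝ := MvPowerSeries.C c

/-- A univariate series `f(t)`, seen as a series in `x, y, t`. -/
noncomputable def inT (f : PowerSeries ℝ) : MvPowerSeries (Fin 3) ℝ :=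
  PowerSeries.subst tVar f

/-- The series `F(a, b)` obtained from `F = F(x, y)` (whose coefficients also depend on `t`) by
replacing `x` by `a` and `y` by `b`.  It is used only for `a`, `b` without constant term. -/
noncomputable def evalXY (F a b : MvPowerSeries (Fin 3) ℝ) : MvPowerSeries (Fin 3) ℝ :=
  MvPowerSeries.subst ![a, b, tVar] F

/-- A power series in `t`, seen as a Laurent series. -/
noncomputable def toLaurent (f : PowerSeries ℝ) : LaurentSeries ℝ :=
  HahnSeries.ofPowerSeries ℤ ℝ f

/-- `s = √f`: the power series `s` is the square root of `f` with positive constant term. -/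
def IsSeriesSqrt {σ : Type*} (s f : MvPowerSeries σ ℝ) : Prop :=
  s ^ 2 = f ∧ 0 < MvPowerSeries.constantCoeff s

namespace QuadrantWalk

/-- The transition probability from one point of the quadrant to another one. -/
def transition (w : QuadrantWalk) : ℕ × ℕ → ℕ × ℕ → ℝ
  | (0, 0), s => if s = (1, 1) then 1 else 0
  | (i + 1, 0), s => if s = (i, 0) then w.p₁ else if s = (i + 2, 1) then w.r₁ else 0
  | (0, j + 1), s => if s = (0, j) then w.q₂ else if s = (1, j + 2) then w.r₂ else 0
  | (i + 1, j + 1), s =>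
      if s = (i, j + 1) then w.p else if s = (i + 1, j) then w.q
      else if s = (i + 2, j + 2) then w.r else 0

/-- `w.law n (i, j)` is the probability that the chain started at the origin
at time `0` is at `(i, j)` at time `n`. -/
noncomputable def law (w : QuadrantWalk) : ℕ → ℕ × ℕ → ℝ
  | 0 => fun s => if s = (0, 0) then 1 else 0
  | n + 1 => fun s => ∑' s' : ℕ × ℕ, w.law n s' * w.transition s' s

/-- The trivariate generating function `∑ p_{i,j}(n) xⁱ yʲ tⁿ`. -/
noncomputable def genFun (w : QuadrantWalk) : MvPowerSeries (Fin 3) ℝ :=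
  fun m => w.law (m 2) (m 0, m 1)

/-- `P_{0,0} = ∑ p_{0,0}(n) tⁿ`. -/
noncomputable def P00 (w : QuadrantWalk) : PowerSeries ℝ :=
  PowerSeries.mk fun n => w.law n (0, 0)

/-- `P₁(x) = ∑_{i > 0} p_{i,0}(n) xⁱ tⁿ`. -/
noncomputable def P1 (w : QuadrantWalk) : MvPowerSeries (Fin 3) ℝ :=
  fun m => if 0 < m 0 ∧ m 1 = 0 then w.law (m 2) (m 0, 0) else 0

/-- `P₂(y) = ∑_{j > 0} p_{0,j}(n) yʲ tⁿ`. -/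
noncomputable def P2 (w : QuadrantWalk) : MvPowerSeries (Fin 3) ℝ :=
  fun m => if m 0 = 0 ∧ 0 < m 1 then w.law (m 2) (0, m 1) else 0

/-- `P(x, y) = ∑_{i, j > 0} p_{i,j}(n) xⁱ yʲ tⁿ`. -/
noncomputable def P (w : QuadrantWalk) : MvPowerSeries (Fin 3) ℝ :=
  fun m => if 0 < m 0 ∧ 0 < m 1 then w.law (m 2) (m 0, m 1) else 0

/-- `Q(x, y) = P_{0,0} + r' P₁(x) + r'' P₂(y) + r P(x, y)`, where `r'`, `r''` are `r₁`, `r₂`. -/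
noncomputable def Q (w : QuadrantWalk) : MvPowerSeries (Fin 3) ℝ :=
  inT w.P00 + const3 w.r₁ * w.P1 + const3 w.r₂ * w.P2 + const3 w.r * w.P

/-- The equation `Z = 1 + 4 p q r t³ Z³`. -/
def IsZ (w : QuadrantWalk) (Z : PowerSeries ℝ) : Prop :=
  Z = 1 + PowerSeries.C (4 * w.p * w.q * w.r) * PowerSeries.X ^ 3 * Z ^ 3

/-- `Δ₊(x) = 1 - 4 p q r t² Z² x`. -/
noncomputable def deltaPlus (w : QuadrantWalk) (Z : PowerSeries ℝ) : MvPowerSeries (Fin 3) ℝ :=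
  1 - const3 (4 * w.p * w.q * w.r) * tVar ^ 2 * inT Z ^ 2 * xVar

end QuadrantWalk

/-- `Δ₋(u) = 1 - t Z (1 + Z) u + t² Z² u²`, for a Laurent series `u` in `t`. -/
noncomputable def deltaMinus (Z : PowerSeries ℝ) (u : LaurentSeries ℝ) : LaurentSeries ℝ :=
  1 - toLaurent (PowerSeries.X * Z * (1 + Z)) * u
    + toLaurent (PowerSeries.X ^ 2 * Z ^ 2) * u ^ 2

/-! The boundary steps are interior steps conditioned to stay in the quadrant. The weights in `Q`
(the probability of a diagonal step) therefore turn the recurrence into one linear functional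
equation, with kernel `xy - t(x + y + p²r x²y²)` once `x, y` are scaled by `p = q`. By reflection,
`Q(0,py)` is the same series as `Q(px,0)` in the other variable, so there is one unknown series `F`.

On the kernel curve, parametrised by `x = tU`, `y = tv`, `Uv = U + v + p²r t³U²v²`, the kernel
cancels `Q(px,py)`. The expression `I(U) = 1/U² - 1/U - p²r t³U` takes the same value at `U` and
`v`. It does two things. Up to a constant it equals `(1-pU)K(U)/U²` with `K(U) = 1 - (1-p)U + pr
t³U²`, which lets the equation be decoupled (`decoupled_of_kernel`): `A = K F - (r/2p)((1-p)U - 2)`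
satisfies `vA(U) + UA(v) = 0`. Moreover `4Z²I + 4Z - 3 = (2Z-U)²Δ₊/U²` precisely because `Z = 1 +
4p²r t³Z³`, so `B = (2Z-U)√Δ₊` satisfies the same relation up to a sign (`sq_eq_sq_of_kernel`),
which is settled at `t = 0`.

Hence `2ZA - γB` is antisymmetric in this sense, and `γ = P₀₀ + r/p` makes it vanish at `U = 0`.
Such a series is zero (`coeff_eq_zero_of_kernel`): its lowest homogeneous part would give a
polynomial excluded by `Polynomial.eq_zero_of_involution_eq`. This expresses `Q(px,0)` through
`P₀₀`; evaluating at the root `W` of `K` then determines `γ²`, and positivity determines `γ`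
(`P00_add_mul`).

For the degree, `Z` is cubic over `ℝ(t)` and `ℝ(t,Z) = ℝ(s)` with `s = tZ`. In `s`, the polynomial
under the root in `γ` has negative leading coefficient, so it is not a square, and `γ` is quadratic
over `ℝ(t,Z)`. Since `γ²` is not in `ℝ(t)`, it generates the whole cubic field, so `γ` has degree
`6`. Algebraicity of the full series follows from the explicit formulas. -/

/-- A self-map of `R⟦X⟧` that improves `X`-adic approximations has a fixed point. -/
theorem PowerSeries.exists_fixedPoint {R : Type*} [CommRing R] (Φ : PowerSeries R → PowerSeries R)
    (hΦ : ∀ (k : ℕ) (f g : PowerSeries R), X ^ k ∣ f - g → X ^ (k + 1) ∣ Φ f - Φ g) :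
    ∃ f, Φ f = f := by
  have step : ∀ n, (X : PowerSeries R) ^ n ∣ Φ^[n + 1] 0 - Φ^[n] 0 := by
    intro n
    induction n with
    | zero => simp
    | succ n ih =>
      have h := hΦ _ _ _ ih
      rwa [← Function.iterate_succ_apply' Φ, ← Function.iterate_succ_apply' Φ] at h
  have far : ∀ n m, n ≤ m → (X : PowerSeries R) ^ n ∣ Φ^[m] 0 - Φ^[n] 0 := by
    intro n m hnm
    induction m, hnm using Nat.le_induction with
    | base => simp
    | succ m hm ih =>
      have h := dvd_add ((pow_dvd_pow X hm).trans (step m)) ih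
      simpa using h
  -- By `far`, the coefficient of index `n` is constant from the iterate `n + 1` on.
  set f : PowerSeries R := mk fun n => coeff n (Φ^[n + 1] 0) with hf
  have hfn : ∀ n, (X : PowerSeries R) ^ n ∣ f - Φ^[n] 0 := by
    intro n
    rw [X_pow_dvd_iff]
    intro m hm
    have := (X_pow_dvd_iff.mp (far (m + 1) n hm)) m (Nat.lt_succ_self m)
    rw [map_sub, sub_eq_zero] at this ⊢
    rw [hf, coeff_mk, this]
  refine ⟨f, sub_eq_zero.mp ?_⟩
  ext n
  have h1 := hΦ n _ _ (hfn n)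
  rw [← Function.iterate_succ_apply' Φ n] at h1
  have h2 := dvd_sub h1 (hfn (n + 1))
  rw [show Φ f - Φ^[n + 1] 0 - (f - Φ^[n + 1] 0) = Φ f - f by ring] at h2
  simpa using X_pow_dvd_iff.mp h2 n (Nat.lt_succ_self n)

/-- The series `√(1 + X)`. -/
noncomputable def sqrtOneAdd : PowerSeries ℝ := PowerSeries.binomialSeries ℝ (1 / 2 : ℝ)

theorem sqrtOneAdd_sq : sqrtOneAdd ^ 2 = 1 + PowerSeries.X := by
  rw [sq, sqrtOneAdd, ← PowerSeries.binomialSeries_add]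
  have := PowerSeries.binomialSeries_nat (R := ℝ) (A := ℝ) 1
  norm_num at this ⊢
  exact this

theorem constantCoeff_sqrtOneAdd : PowerSeries.constantCoeff sqrtOneAdd = 1 :=
  PowerSeries.binomialSeries_constantCoeff _

/-! ### Substitution into trivariate series -/

section Substitution

variable {τ : Type*}

theorem hasSubst_triple {a b c : MvPowerSeries τ ℝ} (ha : MvPowerSeries.constantCoeff a = 0)
    (hb : MvPowerSeries.constantCoeff b = 0) (hc : MvPowerSeries.constantCoeff c = 0) :
    MvPowerSeries.HasSubst ![a, b, c] :=
  MvPowerSeries.hasSubst_of_constantCoeff_zero fun s => by fin_cases s <;> assumption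

/-- Substitution preserves constant coefficients. -/
theorem constantCoeff_subst_of_zero {σ : Type*} {a : σ → MvPowerSeries τ ℝ}
    (ha : MvPowerSeries.HasSubst a) (ha' : ∀ i, (a i).constantCoeff = 0) (f : MvPowerSeries σ ℝ) :
    MvPowerSeries.constantCoeff (MvPowerSeries.subst a f) = MvPowerSeries.constantCoeff f := by
  have h := MvPowerSeries.constantCoeff_subst_eq_zero ha ha'
    (f := f - MvPowerSeries.C (MvPowerSeries.constantCoeff f)) (by simp)
  rw [MvPowerSeries.subst_sub ha, MvPowerSeries.subst_C, map_sub] at h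
  simpa [sub_eq_zero] using h

theorem constantCoeff_powerSeries_subst {a : MvPowerSeries τ ℝ}
    (ha : MvPowerSeries.constantCoeff a = 0) (f : PowerSeries ℝ) :
    MvPowerSeries.constantCoeff (PowerSeries.subst a f) = PowerSeries.constantCoeff f :=
  constantCoeff_subst_of_zero (PowerSeries.HasSubst.of_constantCoeff_zero ha).const
    (fun _ => ha) f

/-- Substitution of three series without constant term for `x, y, t`. -/
noncomputable def substHom (a b c : MvPowerSeries τ ℝ) (ha : MvPowerSeries.constantCoeff a = 0)
    (hb : MvPowerSeries.constantCoeff b = 0) (hc : MvPowerSeries.constantCoeff c = 0) :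
    MvPowerSeries (Fin 3) ℝ →ₐ[ℝ] MvPowerSeries τ ℝ :=
  MvPowerSeries.substAlgHom (hasSubst_triple ha hb hc)

variable {a b c : MvPowerSeries τ ℝ} (ha : MvPowerSeries.constantCoeff a = 0)
  (hb : MvPowerSeries.constantCoeff b = 0) (hc : MvPowerSeries.constantCoeff c = 0)

theorem substHom_eq (f : MvPowerSeries (Fin 3) ℝ) :
    substHom a b c ha hb hc f = MvPowerSeries.subst ![a, b, c] f :=
  MvPowerSeries.substAlgHom_apply _ f

@[simp] theorem substHom_xVar : substHom a b c ha hb hc xVar = a :=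
  MvPowerSeries.substAlgHom_X _ 0

@[simp] theorem substHom_yVar : substHom a b c ha hb hc yVar = b :=
  MvPowerSeries.substAlgHom_X _ 1

@[simp] theorem substHom_tVar : substHom a b c ha hb hc tVar = c :=
  MvPowerSeries.substAlgHom_X _ 2

@[simp] theorem substHom_const3 (r : ℝ) :
    substHom a b c ha hb hc (const3 r) = MvPowerSeries.C r := by
  rw [substHom_eq]; exact MvPowerSeries.subst_C r

theorem constantCoeff_substHom (f : MvPowerSeries (Fin 3) ℝ) :
    MvPowerSeries.constantCoeff (substHom a b c ha hb hc f) = MvPowerSeries.constantCoeff f := by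
  rw [substHom_eq]
  exact constantCoeff_subst_of_zero (hasSubst_triple ha hb hc)
    (fun s => by fin_cases s <;> assumption) f

theorem substHom_subst {d : MvPowerSeries (Fin 3) ℝ} (hd : MvPowerSeries.constantCoeff d = 0)
    (f : PowerSeries ℝ) :
    substHom a b c ha hb hc (PowerSeries.subst d f)
      = PowerSeries.subst (substHom a b c ha hb hc d) f := by
  rw [substHom_eq, substHom_eq, PowerSeries.subst, PowerSeries.subst]
  exact MvPowerSeries.subst_comp_subst_apply
    (PowerSeries.HasSubst.of_constantCoeff_zero hd).const (hasSubst_triple ha hb hc) f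

@[simp] theorem substHom_inT (f : PowerSeries ℝ) :
    substHom a b c ha hb hc (inT f) = PowerSeries.subst c f := by
  rw [inT, substHom_subst _ _ _ (by simp), substHom_tVar]

theorem substHom_substHom {a' b' c' : MvPowerSeries (Fin 3) ℝ}
    (ha' : MvPowerSeries.constantCoeff a' = 0) (hb' : MvPowerSeries.constantCoeff b' = 0)
    (hc' : MvPowerSeries.constantCoeff c' = 0) (f : MvPowerSeries (Fin 3) ℝ) :
    substHom a b c ha hb hc (substHom a' b' c' ha' hb' hc' f)
      = substHom (substHom a b c ha hb hc a') (substHom a b c ha hb hc b')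
          (substHom a b c ha hb hc c') (by rw [constantCoeff_substHom, ha'])
          (by rw [constantCoeff_substHom, hb']) (by rw [constantCoeff_substHom, hc']) f := by
  rw [substHom_eq, substHom_eq, substHom_eq, MvPowerSeries.subst_comp_subst_apply
    (hasSubst_triple ha' hb' hc') (hasSubst_triple ha hb hc)]
  congr 1
  funext s
  fin_cases s <;> simp [substHom_eq]

end Substitution

theorem evalXY_eq_substHom (f : MvPowerSeries (Fin 3) ℝ) {a b : MvPowerSeries (Fin 3) ℝ}
    (ha : MvPowerSeries.constantCoeff a = 0) (hb : MvPowerSeries.constantCoeff b = 0) :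
    evalXY f a b = substHom a b tVar ha hb (by simp) f :=
  (substHom_eq ha hb (by simp) f).symm

/-- `f ↦ inT f` as a ring homomorphism. -/
noncomputable def inTHom : PowerSeries ℝ →ₐ[ℝ] MvPowerSeries (Fin 3) ℝ :=
  PowerSeries.substAlgHom (PowerSeries.HasSubst.X 2)

theorem inTHom_apply (f : PowerSeries ℝ) : inTHom f = inT f := by
  rw [inTHom, PowerSeries.coe_substAlgHom]; rfl

@[simp] theorem inT_X : inT PowerSeries.X = tVar :=
  PowerSeries.subst_X (PowerSeries.HasSubst.X 2)

@[simp] theorem inT_C (c : ℝ) : inT (PowerSeries.C c) = const3 c :=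
  PowerSeries.subst_C c

@[simp] theorem constantCoeff_inT (f : PowerSeries ℝ) :
    MvPowerSeries.constantCoeff (inT f) = PowerSeries.constantCoeff f :=
  constantCoeff_powerSeries_subst (by simp) f

/-! ### Coefficient calculus for series in `x, y, t` -/

/-- The trivariate series with coefficients `c i j n`. -/
noncomputable def ofCoeff (c : ℕ → ℕ → ℕ → ℝ) : MvPowerSeries (Fin 3) ℝ :=
  fun d => c (d 0) (d 1) (d 2)

theorem coeff_ofCoeff (c : ℕ → ℕ → ℕ → ℝ) (d : Fin 3 →₀ ℕ) :
    MvPowerSeries.coeff d (ofCoeff c) = c (d 0) (d 1) (d 2) := rfl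

theorem coeff_X_mul_eq (s : Fin 3) (f : MvPowerSeries (Fin 3) ℝ) (d : Fin 3 →₀ ℕ) :
    MvPowerSeries.coeff d (MvPowerSeries.X s * f)
      = if d s = 0 then 0 else MvPowerSeries.coeff (d - Finsupp.single s 1) f := by
  rw [MvPowerSeries.X, MvPowerSeries.coeff_monomial_mul]
  by_cases h : d s = 0
  · rw [if_neg (by simp [h]), if_pos h]
  · rw [if_pos (by simpa using Nat.one_le_iff_ne_zero.mpr h), if_neg h, one_mul]

theorem xVar_mul_ofCoeff (c : ℕ → ℕ → ℕ → ℝ) :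
    xVar * ofCoeff c = ofCoeff fun i j n => Nat.casesOn i 0 fun i => c i j n := by
  ext d
  rw [coeff_X_mul_eq, coeff_ofCoeff, coeff_ofCoeff]
  cases h : d 0 <;> simp [h]

theorem yVar_mul_ofCoeff (c : ℕ → ℕ → ℕ → ℝ) :
    yVar * ofCoeff c = ofCoeff fun i j n => Nat.casesOn j 0 fun j => c i j n := by
  ext d
  rw [coeff_X_mul_eq, coeff_ofCoeff, coeff_ofCoeff]
  cases h : d 1 <;> simp [h]

theorem tVar_mul_ofCoeff (c : ℕ → ℕ → ℕ → ℝ) :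
    tVar * ofCoeff c = ofCoeff fun i j n => Nat.casesOn n 0 fun n => c i j n := by
  ext d
  rw [coeff_X_mul_eq, coeff_ofCoeff, coeff_ofCoeff]
  cases h : d 2 <;> simp [h]

theorem const3_mul_ofCoeff (a : ℝ) (c : ℕ → ℕ → ℕ → ℝ) :
    const3 a * ofCoeff c = ofCoeff fun i j n => a * c i j n := by
  ext d
  rw [MvPowerSeries.coeff_C_mul, coeff_ofCoeff, coeff_ofCoeff]

theorem ofCoeff_add (c e : ℕ → ℕ → ℕ → ℝ) :
    ofCoeff c + ofCoeff e = ofCoeff fun i j n => c i j n + e i j n := rfl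

theorem const3_eq_ofCoeff (a : ℝ) :
    const3 a = ofCoeff fun i j n => if i = 0 ∧ j = 0 ∧ n = 0 then a else 0 := by
  ext d
  rw [coeff_ofCoeff, MvPowerSeries.coeff_C]
  congr 1
  simp [Finsupp.ext_iff, Fin.forall_fin_succ]

theorem inT_eq_ofCoeff (f : PowerSeries ℝ) :
    inT f = ofCoeff fun i j n => if i = 0 ∧ j = 0 then PowerSeries.coeff n f else 0 := by
  ext d
  rw [coeff_ofCoeff, inT, tVar, PowerSeries.coeff_subst_single]
  congr 1
  simp [Finsupp.ext_iff, Fin.forall_fin_succ]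

/-! ### Recurrence, functional equation and symmetry of the walk -/

namespace QuadrantWalk

variable (w : QuadrantWalk)

/-- The probability of the diagonal step from a given point. -/
def up : ℕ × ℕ → ℝ
  | (0, 0) => 1
  | (_ + 1, 0) => w.r₁
  | (0, _ + 1) => w.r₂
  | (_ + 1, _ + 1) => w.r

theorem transition_up (i j : ℕ) : w.transition (i, j) (i + 1, j + 1) = w.up (i, j) := by
  cases i <;> cases j <;> simp [transition, up]

theorem law_succ_eq_sum (n : ℕ) (s : ℕ × ℕ) (A : Finset (ℕ × ℕ))
    (hA : ∀ s' ∉ A, w.transition s' s = 0) :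
    w.law (n + 1) s = ∑ s' ∈ A, w.law n s' * w.transition s' s :=
  tsum_eq_sum fun s' hs' => by rw [hA s' hs', mul_zero]

theorem law_succ_origin (n : ℕ) :
    w.law (n + 1) (0, 0) = w.law n (1, 0) * w.p₁ + w.law n (0, 1) * w.q₂ := by
  rw [w.law_succ_eq_sum n _ {(1, 0), (0, 1)}]
  · simp [transition]
  · rintro ⟨_ | i, _ | j⟩ h <;> simp_all [transition] <;> omega

theorem law_succ_horizontal (n i : ℕ) :
    w.law (n + 1) (i + 1, 0) = w.law n (i + 2, 0) * w.p₁ + w.law n (i + 1, 1) * w.q := by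
  rw [w.law_succ_eq_sum n _ {(i + 2, 0), (i + 1, 1)}]
  · simp [transition]
  · rintro ⟨_ | i, _ | j⟩ h <;> simp_all [transition] <;> omega

theorem law_succ_vertical (n j : ℕ) :
    w.law (n + 1) (0, j + 1) = w.law n (0, j + 2) * w.q₂ + w.law n (1, j + 1) * w.p := by
  rw [w.law_succ_eq_sum n _ {(0, j + 2), (1, j + 1)}]
  · simp [transition]
  · rintro ⟨_ | i, _ | j⟩ h <;> simp_all [transition] <;> omega

theorem law_succ_interior (n i j : ℕ) :
    w.law (n + 1) (i + 1, j + 1) = w.law n (i + 2, j + 1) * w.p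
      + (w.law n (i + 1, j + 2) * w.q + w.law n (i, j) * w.up (i, j)) := by
  rw [w.law_succ_eq_sum n _ {(i + 2, j + 1), (i + 1, j + 2), (i, j)},
    Finset.sum_insert (by simp), Finset.sum_insert (by simp), Finset.sum_singleton,
    transition_up]
  · simp [transition]
  · rintro ⟨_ | i, _ | j⟩ h <;> simp_all [transition] <;>
      first
      | omega
      | rw [if_neg (by omega), if_neg (by omega), if_neg (by omega)]

/-- Every step changes `n + i + j` by `0` or `3`. -/
theorem law_eq_zero (n : ℕ) : ∀ i j : ℕ, ¬ 3 ∣ n + i + j → w.law n (i, j) = 0 := by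
  induction n with
  | zero =>
    intro i j h
    simp only [law]
    rw [if_neg]
    rintro h'
    simp_all
  | succ n ih =>
    rintro (_ | i) (_ | j) h
    · rw [law_succ_origin, ih _ _ (by omega), ih _ _ (by omega)]; simp
    · rw [law_succ_vertical, ih _ _ (by omega), ih _ _ (by omega)]; simp
    · rw [law_succ_horizontal, ih _ _ (by omega), ih _ _ (by omega)]; simp
    · rw [law_succ_interior, ih _ _ (by omega), ih _ _ (by omega), ih i j (by omega)]; simp

theorem law_zero (s : ℕ × ℕ) : w.law 0 s = if s = (0, 0) then 1 else 0 := rfl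

theorem Q_eq_ofCoeff : w.Q = ofCoeff fun i j n => w.up (i, j) * w.law n (i, j) := by
  ext d
  rw [Q, inT_eq_ofCoeff, map_add, map_add, map_add, MvPowerSeries.coeff_C_mul,
    MvPowerSeries.coeff_C_mul, MvPowerSeries.coeff_C_mul, coeff_ofCoeff, coeff_ofCoeff]
  simp only [MvPowerSeries.coeff_apply, P1, P2, P]
  rcases h0 : d 0 with _ | i <;> rcases h1 : d 1 with _ | j <;> simp [up, P00]

/-- `Q(x, 0)`. -/
noncomputable def Qx : MvPowerSeries (Fin 3) ℝ := inT w.P00 + const3 w.r₁ * w.P1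

/-- `Q(0, y)`. -/
noncomputable def Qy : MvPowerSeries (Fin 3) ℝ := inT w.P00 + const3 w.r₂ * w.P2

theorem Qx_eq_ofCoeff :
    w.Qx = ofCoeff fun i j n => if j = 0 then w.up (i, 0) * w.law n (i, 0) else 0 := by
  ext d
  rw [Qx, inT_eq_ofCoeff, map_add, MvPowerSeries.coeff_C_mul, coeff_ofCoeff, coeff_ofCoeff]
  simp only [MvPowerSeries.coeff_apply, P1]
  rcases h0 : d 0 with _ | i <;> rcases h1 : d 1 with _ | j <;> simp [up, P00]

theorem Qy_eq_ofCoeff :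
    w.Qy = ofCoeff fun i j n => if i = 0 then w.up (0, j) * w.law n (0, j) else 0 := by
  ext d
  rw [Qy, inT_eq_ofCoeff, map_add, MvPowerSeries.coeff_C_mul, coeff_ofCoeff, coeff_ofCoeff]
  simp only [MvPowerSeries.coeff_apply, P2]
  rcases h0 : d 0 with _ | i <;> rcases h1 : d 1 with _ | j <;> simp [up, P00]

/-- The pair `(p₁, r₁)` is `(p, r)` divided by `p + r = 1 - q`. Consequently `r` times the law is
the `up`-weighted law, reduced by its `q`-multiple on the horizontal axis and by its `p`-multiple on
the vertical one. -/
theorem r_eq_mul_r₁ (hα : w.p / w.r = w.p₁ / w.r₁) : w.r = (1 - w.q) * w.r₁ := by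
  have h := hα
  rw [div_eq_div_iff w.r_pos.ne' w.r₁_pos.ne'] at h
  linear_combination -w.r * w.sum_horizontal + w.r₁ * w.sum_interior - h

theorem r_eq_mul_r₂ (hβ : w.q / w.r = w.q₂ / w.r₂) : w.r = (1 - w.p) * w.r₂ := by
  have h := hβ
  rw [div_eq_div_iff w.r_pos.ne' w.r₂_pos.ne'] at h
  linear_combination -w.r * w.sum_vertical + w.r₂ * w.sum_interior - h

/-- The functional equation of the walk, before the rescaling of `x` and `y`. -/
theorem functional_equation (hα : w.p / w.r = w.p₁ / w.r₁) (hβ : w.q / w.r = w.q₂ / w.r₂) :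
    xVar * (yVar * w.Q) + const3 w.q * (tVar * (xVar * w.Qx)) + const3 w.p * (tVar * (yVar * w.Qy))
      = const3 w.p * (tVar * (yVar * w.Q)) + const3 w.q * (tVar * (xVar * w.Q))
        + const3 w.r * (tVar * (xVar * (xVar * (yVar * (yVar * w.Q)))))
        + xVar * (yVar * const3 w.r)
        + const3 w.q * (xVar * (yVar * w.Qx)) + const3 w.p * (xVar * (yVar * w.Qy)) := by
  -- The recurrence is multiplied by `r`. The relations `hp`, `hq` make the left and down steps
  -- carry the weights `p`, `q` times coefficients of `Q` everywhere; `h₁`, `h₂` give the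
  -- corrections on the axes, where one of these steps is forbidden.
  have h₁ := w.r_eq_mul_r₁ hα
  have h₂ := w.r_eq_mul_r₂ hβ
  have hp : w.p * w.r₁ = w.p₁ * w.r := (div_eq_div_iff w.r_pos.ne' w.r₁_pos.ne').mp hα
  have hq : w.q * w.r₂ = w.q₂ * w.r := (div_eq_div_iff w.r_pos.ne' w.r₂_pos.ne').mp hβ
  have hs := w.sum_interior
  simp only [Q_eq_ofCoeff, Qx_eq_ofCoeff, Qy_eq_ofCoeff, const3_eq_ofCoeff w.r, xVar_mul_ofCoeff,
    yVar_mul_ofCoeff, tVar_mul_ofCoeff]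
  rw [← const3_eq_ofCoeff]
  simp only [const3_mul_ofCoeff, ofCoeff_add]
  congr 1
  funext i j n
  rcases n with _ | n
  -- At time `0` only the coefficient of `xy` is nontrivial; it reads `1 = r + q + p`.
  · rcases i with _ | _ | i <;> rcases j with _ | _ | j <;> simp [law_zero, up]
    linarith
  · rcases i with _ | _ | i <;> rcases j with _ | _ | j <;>
      simp [law_succ_origin, law_succ_horizontal, law_succ_vertical, law_succ_interior]
    all_goals simp only [up]
    · linear_combination
        -(w.law n (1, 0) * w.p₁ + w.law n (0, 1) * w.q₂) * hs - w.law n (1, 0) * hp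
          - w.law n (0, 1) * hq
    · linear_combination -(w.law n (0, j + 2) * w.q₂ + w.law n (1, j + 1) * w.p) * h₂
        - w.law n (0, j + 2) * hq
    · linear_combination -(w.law n (i + 2, 0) * w.p₁ + w.law n (i + 1, 1) * w.q) * h₁
        - w.law n (i + 2, 0) * hp
    · rcases i with _ | i <;> rcases j with _ | j <;> ring

/-- When `p = q`, the proportionality relations force `r₁ = r₂` and `p₁ = q₂`, so reflection in the
diagonal preserves the chain. The weighted form is the one that concerns the coefficients of `Q`. -/
theorem up_mul_law_symm (hα : w.p / w.r = w.p₁ / w.r₁) (hβ : w.q / w.r = w.q₂ / w.r₂)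
    (hpq : w.p = w.q) (n : ℕ) :
    ∀ i j, w.up (i, j) * w.law n (i, j) = w.up (j, i) * w.law n (j, i) := by
  have h₁ := w.r_eq_mul_r₁ hα
  have h₂ := w.r_eq_mul_r₂ hβ
  have hr : w.r₁ = w.r₂ := by
    have h0 : (1 - w.q) ≠ 0 := by linarith [w.p_pos, w.r_pos, w.sum_interior]
    apply mul_left_cancel₀ h0
    rw [← h₁, h₂, hpq]
  have hp : w.p₁ = w.q₂ := by linarith [w.sum_horizontal, w.sum_vertical]
  induction n with
  | zero => rintro (_ | i) (_ | j) <;> simp [law_zero, up]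
  | succ n ih =>
    have axis : ∀ k, w.law n (0, k + 1) = w.law n (k + 1, 0) := fun k =>
      mul_left_cancel₀ w.r₂_pos.ne' (by simpa [up, hr] using ih 0 (k + 1))
    have interior : ∀ k l, w.law n (k + 1, l + 1) = w.law n (l + 1, k + 1) := fun k l =>
      mul_left_cancel₀ w.r_pos.ne' (by simpa [up] using ih (k + 1) (l + 1))
    rintro (_ | i) (_ | j)
    · rfl
    · simp only [up, law_succ_vertical, law_succ_horizontal]
      rw [axis, interior 0 j, hr, hp, hpq]
    · simp only [up, law_succ_vertical, law_succ_horizontal]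
      rw [axis, interior 0 i, hr, hp, hpq]
    · rw [law_succ_interior, law_succ_interior, show w.up (i + 1, j + 1) = w.r from rfl,
        show w.up (j + 1, i + 1) = w.r from rfl, interior (i + 1) j, interior i (j + 1), mul_comm (w.law n (i, j)),
        mul_comm (w.law n (j, i)), ih i j, hpq]
      ring

end QuadrantWalk

/-! ### Specializations of `Q` and rescaling by `p` -/

theorem coeff_substHom {τ : Type*} {a b c : MvPowerSeries τ ℝ}
    (ha : MvPowerSeries.constantCoeff a = 0)
    (hb : MvPowerSeries.constantCoeff b = 0) (hc : MvPowerSeries.constantCoeff c = 0)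
    (f : MvPowerSeries (Fin 3) ℝ) (e : τ →₀ ℕ) :
    MvPowerSeries.coeff e (substHom a b c ha hb hc f)
      = ∑ᶠ d, MvPowerSeries.coeff d f * MvPowerSeries.coeff e (a ^ d 0 * b ^ d 1 * c ^ d 2) := by
  rw [substHom_eq, MvPowerSeries.coeff_subst (hasSubst_triple ha hb hc)]
  refine finsum_congr fun d => ?_
  rw [Finsupp.prod_fintype _ _ (by simp), Fin.prod_univ_three, smul_eq_mul]
  simp

/-- Substituting `y` for `x` in a series in `x, t`. -/
theorem substHom_yVar_zero_ofCoeff (c : ℕ → ℕ → ℝ) :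
    substHom yVar 0 tVar (MvPowerSeries.constantCoeff_X 1) (map_zero _)
        (MvPowerSeries.constantCoeff_X 2)
        (ofCoeff fun i j n => if j = 0 then c i n else 0)
      = ofCoeff fun i j n => if i = 0 then c j n else 0 := by
  ext e
  rw [coeff_substHom, coeff_ofCoeff]
  have hmon : ∀ d : Fin 3 →₀ ℕ, d 1 = 0 → (yVar ^ d 0 * (0 : MvPowerSeries (Fin 3) ℝ) ^ d 1
      * tVar ^ d 2) = MvPowerSeries.monomial
        (Finsupp.single 1 (d 0) + Finsupp.single 2 (d 2)) 1 := by
    intro d hd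
    rw [hd, pow_zero, mul_one, MvPowerSeries.X_pow_eq, MvPowerSeries.X_pow_eq,
      MvPowerSeries.monomial_mul_monomial, one_mul]
  rw [finsum_eq_single _ (Finsupp.single 0 (e 1) + Finsupp.single 2 (e 2))]
  · rw [coeff_ofCoeff, hmon _ (by simp), MvPowerSeries.coeff_monomial]
    simp [Finsupp.ext_iff, Fin.forall_fin_succ]
  · intro d hd
    rw [coeff_ofCoeff]
    by_cases h1 : d 1 = 0
    · rw [hmon _ h1, MvPowerSeries.coeff_monomial_ne, mul_zero]
      rintro rfl
      apply hd
      ext s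
      fin_cases s <;> simp [h1]
    · rw [if_neg h1, zero_mul]

section Specialization

variable {τ : Type*} {a b b' c : MvPowerSeries τ ℝ}

theorem substHom_congr_of_coeff_zero (ha : MvPowerSeries.constantCoeff a = 0)
    (h0 : MvPowerSeries.constantCoeff (0 : MvPowerSeries τ ℝ) = 0)
    (hc : MvPowerSeries.constantCoeff c = 0) {f g : MvPowerSeries (Fin 3) ℝ}
    (hfg : ∀ d : Fin 3 →₀ ℕ, d 1 = 0 → MvPowerSeries.coeff d f = MvPowerSeries.coeff d g) :
    substHom a 0 c ha h0 hc f = substHom a 0 c ha h0 hc g := by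
  ext e
  rw [coeff_substHom, coeff_substHom]
  refine finsum_congr fun d => ?_
  by_cases h : d 1 = 0
  · rw [hfg d h]
  · simp [zero_pow h]

theorem substHom_congr_of_coeff_zero' (hb : MvPowerSeries.constantCoeff b = 0)
    (h0 : MvPowerSeries.constantCoeff (0 : MvPowerSeries τ ℝ) = 0)
    (hc : MvPowerSeries.constantCoeff c = 0) {f g : MvPowerSeries (Fin 3) ℝ}
    (hfg : ∀ d : Fin 3 →₀ ℕ, d 0 = 0 → MvPowerSeries.coeff d f = MvPowerSeries.coeff d g) :
    substHom 0 b c h0 hb hc f = substHom 0 b c h0 hb hc g := by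
  ext e
  rw [coeff_substHom, coeff_substHom]
  refine finsum_congr fun d => ?_
  by_cases h : d 0 = 0
  · rw [hfg d h]
  · simp [zero_pow h]

/-- The value of a series that does not involve `y` does not depend on what is put for `y`. -/
theorem substHom_eq_of_free_of_y (ha : MvPowerSeries.constantCoeff a = 0)
    (hb : MvPowerSeries.constantCoeff b = 0) (hb' : MvPowerSeries.constantCoeff b' = 0)
    (hc : MvPowerSeries.constantCoeff c = 0) {f : MvPowerSeries (Fin 3) ℝ}
    (hf : ∀ d : Fin 3 →₀ ℕ, d 1 ≠ 0 → MvPowerSeries.coeff d f = 0) :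
    substHom a b c ha hb hc f = substHom a b' c ha hb' hc f := by
  ext e
  rw [coeff_substHom, coeff_substHom]
  refine finsum_congr fun d => ?_
  by_cases h : d 1 = 0
  · simp [h]
  · simp [hf d h]

theorem substHom_eq_of_free_of_x (ha : MvPowerSeries.constantCoeff a = 0)
    (hb : MvPowerSeries.constantCoeff b = 0) (hb' : MvPowerSeries.constantCoeff b' = 0)
    (hc : MvPowerSeries.constantCoeff c = 0) {f : MvPowerSeries (Fin 3) ℝ}
    (hf : ∀ d : Fin 3 →₀ ℕ, d 0 ≠ 0 → MvPowerSeries.coeff d f = 0) :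
    substHom b a c hb ha hc f = substHom b' a c hb' ha hc f := by
  ext e
  rw [coeff_substHom, coeff_substHom]
  refine finsum_congr fun d => ?_
  by_cases h : d 0 = 0
  · simp [h]
  · simp [hf d h]

end Specialization

theorem constantCoeff_const3_mul_X (p : ℝ) (s : Fin 3) :
    MvPowerSeries.constantCoeff (const3 p * MvPowerSeries.X s) = 0 := by simp

namespace QuadrantWalk

variable (w : QuadrantWalk)

theorem coeff_Qx_of_ne {d : Fin 3 →₀ ℕ} (hd : d 1 ≠ 0) : MvPowerSeries.coeff d w.Qx = 0 := by
  rw [Qx_eq_ofCoeff, coeff_ofCoeff, if_neg hd]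

theorem coeff_Qy_of_ne {d : Fin 3 →₀ ℕ} (hd : d 0 ≠ 0) : MvPowerSeries.coeff d w.Qy = 0 := by
  rw [Qy_eq_ofCoeff, coeff_ofCoeff, if_neg hd]

theorem coeff_Q_of_eq_zero {d : Fin 3 →₀ ℕ} (hd : d 1 = 0) :
    MvPowerSeries.coeff d w.Q = MvPowerSeries.coeff d w.Qx := by
  rw [Qx_eq_ofCoeff, Q_eq_ofCoeff, coeff_ofCoeff, coeff_ofCoeff, if_pos hd, hd]

theorem coeff_Q_of_eq_zero' {d : Fin 3 →₀ ℕ} (hd : d 0 = 0) :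
    MvPowerSeries.coeff d w.Q = MvPowerSeries.coeff d w.Qy := by
  rw [Qy_eq_ofCoeff, Q_eq_ofCoeff, coeff_ofCoeff, coeff_ofCoeff, if_pos hd, hd]

/-- `Q(px, 0)`. -/
noncomputable def Qpx : MvPowerSeries (Fin 3) ℝ :=
  substHom (const3 w.p * xVar) 0 tVar (constantCoeff_const3_mul_X _ _) (map_zero _)
    (MvPowerSeries.constantCoeff_X 2) w.Qx

/-- `Q(0, py)`. -/
noncomputable def Qpy : MvPowerSeries (Fin 3) ℝ :=
  substHom 0 (const3 w.p * yVar) tVar (map_zero _) (constantCoeff_const3_mul_X _ _)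
    (MvPowerSeries.constantCoeff_X 2) w.Qy

theorem evalXY_Q_px_zero : evalXY w.Q (const3 w.p * xVar) 0 = w.Qpx := by
  rw [evalXY_eq_substHom _ (constantCoeff_const3_mul_X _ _) (map_zero _)]
  exact substHom_congr_of_coeff_zero _ _ _ fun d => w.coeff_Q_of_eq_zero

theorem evalXY_Q_zero_py : evalXY w.Q 0 (const3 w.p * yVar) = w.Qpy := by
  rw [evalXY_eq_substHom _ (map_zero _) (constantCoeff_const3_mul_X _ _)]
  exact substHom_congr_of_coeff_zero' _ _ _ fun d => w.coeff_Q_of_eq_zero'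

theorem Qpx_eq : w.Qpx = inT w.P00 + const3 w.r₁ * evalXY w.P1 (const3 w.p * xVar) 0 := by
  rw [evalXY_eq_substHom _ (constantCoeff_const3_mul_X _ _) (map_zero _), Qpx, Qx, map_add,
    map_mul, substHom_const3, substHom_inT]
  rfl

theorem substHom_zero_Qx {τ : Type*} {b c : MvPowerSeries τ ℝ}
    (h0 : MvPowerSeries.constantCoeff (0 : MvPowerSeries τ ℝ) = 0)
    (hb : MvPowerSeries.constantCoeff b = 0) (hc : MvPowerSeries.constantCoeff c = 0) :
    substHom 0 b c h0 hb hc w.Qx = PowerSeries.subst c w.P00 := by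
  rw [← substHom_inT h0 hb hc]
  refine (substHom_eq_of_free_of_y _ _ h0 _ fun d => w.coeff_Qx_of_ne).trans ?_
  refine Eq.trans ?_ (substHom_eq_of_free_of_y h0 h0 hb hc ?_)
  · refine substHom_congr_of_coeff_zero' _ _ _ fun d hd => ?_
    rw [Qx_eq_ofCoeff, inT_eq_ofCoeff, coeff_ofCoeff, coeff_ofCoeff]
    simp [hd, up, P00]
  · intro d hd
    rw [inT_eq_ofCoeff, coeff_ofCoeff, if_neg (by tauto)]

theorem evalXY_Qpx_zero : evalXY w.Qpx 0 0 = inT w.P00 := by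
  rw [evalXY_eq_substHom _ (map_zero _) (map_zero _), Qpx, substHom_substHom]
  simp only [map_mul, map_zero, substHom_xVar, substHom_tVar, mul_zero, substHom_zero_Qx]
  rfl

theorem Qy_eq_substHom (hα : w.p / w.r = w.p₁ / w.r₁) (hβ : w.q / w.r = w.q₂ / w.r₂)
    (hpq : w.p = w.q) :
    w.Qy = substHom yVar 0 tVar (MvPowerSeries.constantCoeff_X 1) (map_zero _)
        (MvPowerSeries.constantCoeff_X 2) w.Qx := by
  rw [Qx_eq_ofCoeff, Qy_eq_ofCoeff, substHom_yVar_zero_ofCoeff]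
  simp only [fun n j => w.up_mul_law_symm hα hβ hpq n 0 j]

theorem Qpy_eq_evalXY (hα : w.p / w.r = w.p₁ / w.r₁) (hβ : w.q / w.r = w.q₂ / w.r₂)
    (hpq : w.p = w.q) : w.Qpy = evalXY w.Qpx yVar 0 := by
  rw [evalXY_eq_substHom _ (MvPowerSeries.constantCoeff_X 1) (map_zero _), Qpx, Qpy,
    w.Qy_eq_substHom hα hβ hpq, substHom_substHom, substHom_substHom]
  simp only [map_mul, map_zero, substHom_xVar, substHom_yVar, substHom_tVar, substHom_const3]

/-- `Q(px, py)`. -/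
noncomputable def Qpxy : MvPowerSeries (Fin 3) ℝ :=
  substHom (const3 w.p * xVar) (const3 w.p * yVar) tVar (constantCoeff_const3_mul_X _ _)
    (constantCoeff_const3_mul_X _ _) (MvPowerSeries.constantCoeff_X 2) w.Q

theorem evalXY_Q_px_py : evalXY w.Q (const3 w.p * xVar) (const3 w.p * yVar) = w.Qpxy :=
  evalXY_eq_substHom _ (constantCoeff_const3_mul_X _ _) (constantCoeff_const3_mul_X _ _)

theorem substHom_px_py_Qx :
    substHom (const3 w.p * xVar) (const3 w.p * yVar) tVar (constantCoeff_const3_mul_X _ _)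
      (constantCoeff_const3_mul_X _ _) (MvPowerSeries.constantCoeff_X 2) w.Qx = w.Qpx :=
  substHom_eq_of_free_of_y _ _ _ _ fun _ => w.coeff_Qx_of_ne

theorem substHom_px_py_Qy :
    substHom (const3 w.p * xVar) (const3 w.p * yVar) tVar (constantCoeff_const3_mul_X _ _)
      (constantCoeff_const3_mul_X _ _) (MvPowerSeries.constantCoeff_X 2) w.Qy = w.Qpy :=
  substHom_eq_of_free_of_x _ _ _ _ fun _ => w.coeff_Qy_of_ne

theorem const3_ne_zero {c : ℝ} (hc : c ≠ 0) : const3 c ≠ 0 := by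
  intro h
  apply hc
  simpa using congrArg MvPowerSeries.constantCoeff h

/-- The scaling `x ↦ px`, `y ↦ py` makes the kernel symmetric; a common factor `p²` then cancels. -/
theorem functional_equation_symm (hα : w.p / w.r = w.p₁ / w.r₁)
    (hβ : w.q / w.r = w.q₂ / w.r₂) (hpq : w.p = w.q) :
    (xVar * yVar - tVar * (xVar + yVar + const3 (w.p * w.q * w.r) * xVar ^ 2 * yVar ^ 2)) * w.Qpxy
      = const3 w.r * xVar * yVar - (tVar - const3 w.p * yVar) * xVar * w.Qpx
        - (tVar - const3 w.p * xVar) * yVar * w.Qpy := by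
  have h := congrArg (substHom (const3 w.p * xVar) (const3 w.p * yVar) tVar
    (constantCoeff_const3_mul_X _ _) (constantCoeff_const3_mul_X _ _)
    (MvPowerSeries.constantCoeff_X 2)) (w.functional_equation hα hβ)
  simp only [map_mul, map_add, substHom_xVar, substHom_yVar, substHom_tVar, substHom_const3,
    substHom_px_py_Qx, substHom_px_py_Qy, ← hpq] at h
  change _ * (_ * w.Qpxy) + _ + _ = _ * (_ * (_ * w.Qpxy)) + _ * (_ * (_ * w.Qpxy)) +
    _ * (_ * (_ * (_ * (_ * (_ * w.Qpxy))))) + _ + _ + _ at h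
  apply mul_left_cancel₀ (pow_ne_zero 2 (const3_ne_zero w.p_pos.ne'))
  rw [← hpq]
  simp only [const3, map_mul] at h ⊢
  linear_combination h

/-- The quadrant is split into the origin, the open axes and the interior, and the weight of `Q` is
divided out on each piece. -/
theorem genFun_eq : w.genFun = inT w.P00 + const3 (1 / w.r₁) * (w.Qx - inT w.P00)
    + const3 (1 / w.r₂) * (w.Qy - inT w.P00)
    + const3 (1 / w.r) * (w.Q - w.Qx - w.Qy + inT w.P00) := by
  ext d
  have h₁ := w.r₁_pos.ne'
  have h₂ := w.r₂_pos.ne'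
  have h := w.r_pos.ne'
  rw [Qx_eq_ofCoeff, Qy_eq_ofCoeff, Q_eq_ofCoeff, inT_eq_ofCoeff]
  simp only [map_add, map_sub, MvPowerSeries.coeff_C_mul, coeff_ofCoeff]
  rw [MvPowerSeries.coeff_apply, genFun]
  rcases h0 : d 0 with _ | i <;> rcases h1 : d 1 with _ | j <;> simp [up, P00, h₁, h₂, h]

theorem evalXY_genFun :
    evalXY w.genFun (const3 w.p * xVar) (const3 w.p * yVar) = inT w.P00
      + const3 (1 / w.r₁) * (w.Qpx - inT w.P00) + const3 (1 / w.r₂) * (w.Qpy - inT w.P00)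
      + const3 (1 / w.r) * (w.Qpxy - w.Qpx - w.Qpy + inT w.P00) := by
  rw [evalXY_eq_substHom _ (constantCoeff_const3_mul_X _ _) (constantCoeff_const3_mul_X _ _),
    genFun_eq]
  simp only [map_mul, map_add, map_sub, substHom_const3, substHom_inT, substHom_px_py_Qx,
    substHom_px_py_Qy]
  rfl

end QuadrantWalk

/-! ### Evaluation at `x = t a(t)` and uniqueness in the kernel method -/

theorem mvConstantCoeff_X : MvPowerSeries.constantCoeff (PowerSeries.X : PowerSeries ℝ) = 0 :=
  MvPowerSeries.constantCoeff_X _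

theorem mvConstantCoeff_X_mul (a : PowerSeries ℝ) :
    MvPowerSeries.constantCoeff (PowerSeries.X * a) = 0 := by
  rw [map_mul, mvConstantCoeff_X, zero_mul]

/-- Evaluation of a trivariate series at `x = t a(t)`, `y = t b(t)`. -/
noncomputable def evalT (a b : PowerSeries ℝ) : MvPowerSeries (Fin 3) ℝ →ₐ[ℝ] PowerSeries ℝ :=
  substHom (PowerSeries.X * a) (PowerSeries.X * b) PowerSeries.X
    (mvConstantCoeff_X_mul a) (mvConstantCoeff_X_mul b) mvConstantCoeff_X

section EvalT

variable (a b : PowerSeries ℝ)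

theorem evalT_xVar : evalT a b xVar = PowerSeries.X * a := substHom_xVar _ _ _
theorem evalT_yVar : evalT a b yVar = PowerSeries.X * b := substHom_yVar _ _ _
theorem evalT_tVar : evalT a b tVar = PowerSeries.X := substHom_tVar _ _ _
theorem evalT_const3 (r : ℝ) : evalT a b (const3 r) = PowerSeries.C r := substHom_const3 _ _ _ r
theorem evalT_inT (f : PowerSeries ℝ) : evalT a b (inT f) = f :=
  (substHom_inT _ _ _ f).trans (PowerSeries.X_subst f)
theorem constantCoeff_evalT (f : MvPowerSeries (Fin 3) ℝ) :
    PowerSeries.constantCoeff (evalT a b f) = MvPowerSeries.constantCoeff f :=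
  constantCoeff_substHom _ _ _ f

theorem evalT_substHom {a' b' : MvPowerSeries (Fin 3) ℝ} {a₁ b₁ : PowerSeries ℝ}
    (ha' : MvPowerSeries.constantCoeff a' = 0) (hb' : MvPowerSeries.constantCoeff b' = 0)
    (hc' : MvPowerSeries.constantCoeff tVar = 0) (ha₁ : evalT a b a' = PowerSeries.X * a₁)
    (hb₁ : evalT a b b' = PowerSeries.X * b₁) (f : MvPowerSeries (Fin 3) ℝ) :
    evalT a b (substHom a' b' tVar ha' hb' hc' f) = evalT a₁ b₁ f := by
  unfold evalT at *
  rw [substHom_substHom]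
  congr 1
  simp only [ha₁, hb₁, substHom_tVar]

end EvalT

/-- The triple of exponents `(i, 0, n)`. -/
noncomputable def exponents (i n : ℕ) : Fin 3 →₀ ℕ := Finsupp.single 0 i + Finsupp.single 2 n

theorem eq_exponents {d : Fin 3 →₀ ℕ} (h : d 1 = 0) : d = exponents (d 0) (d 2) := by
  ext s
  fin_cases s <;> simp [exponents, h]

/-- The part of total degree `m` of the evaluation at `x = t a(t)`, `y = 0`, when the series has
no terms of smaller degree. -/
theorem coeff_evalT_zero (f : MvPowerSeries (Fin 3) ℝ) (m : ℕ)
    (hf : ∀ i n, i + n < m → MvPowerSeries.coeff (exponents i n) f = 0) (a : PowerSeries ℝ) :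
    PowerSeries.coeff m (evalT a 0 f) = ∑ i ∈ Finset.range (m + 1),
      MvPowerSeries.coeff (exponents i (m - i)) f * PowerSeries.constantCoeff a ^ i := by
  have key : ∀ i n, PowerSeries.coeff m ((PowerSeries.X * a) ^ i * PowerSeries.X ^ n)
      = if i + n ≤ m then PowerSeries.coeff (m - (i + n)) (a ^ i) else 0 := by
    intro i n
    rw [mul_pow, mul_right_comm, ← pow_add, PowerSeries.coeff_X_pow_mul']
  unfold evalT PowerSeries.coeff
  rw [coeff_substHom]
  have hterm : ∀ d : Fin 3 →₀ ℕ, MvPowerSeries.coeff d f * MvPowerSeries.coeff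
      (Finsupp.single () m) ((PowerSeries.X * a) ^ d 0 * (PowerSeries.X * (0 : PowerSeries ℝ)) ^ d 1
        * PowerSeries.X ^ d 2) = if d 1 = 0 ∧ d 0 + d 2 = m then
          MvPowerSeries.coeff d f * PowerSeries.constantCoeff a ^ d 0 else 0 := by
    intro d
    by_cases h1 : d 1 = 0
    · have := key (d 0) (d 2)
      rw [PowerSeries.coeff] at this
      rw [h1, pow_zero, mul_one, this]
      -- Terms of lower degree vanish by `hf`, those of higher degree contribute too large a power
      -- of `t`; in degree `m` only the constant term of `a` matters.
      rcases lt_trichotomy (d 0 + d 2) m with h | h | h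
      · have hz : MvPowerSeries.coeff d f = 0 := by rw [eq_exponents h1, hf _ _ h]
        rw [hz, zero_mul, if_neg (by omega)]
      · rw [if_pos h.le, if_pos ⟨rfl, h⟩, h, Nat.sub_self, PowerSeries.coeff_zero_eq_constantCoeff,
          map_pow]
      · rw [if_neg (by omega), if_neg (by omega), mul_zero]
    · rw [mul_zero, zero_pow h1, if_neg (by tauto), mul_zero, zero_mul, map_zero, mul_zero]
  rw [finsum_congr hterm]
  rw [finsum_eq_sum_of_support_subset
    (s := (Finset.range (m + 1)).image fun i => exponents i (m - i))]
  · rw [Finset.sum_image]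
    · refine Finset.sum_congr rfl fun i hi => ?_
      have hi' := Finset.mem_range.mp hi
      have h0 : exponents i (m - i) 0 = i := by simp [exponents]
      have h1 : exponents i (m - i) 1 = 0 := by simp [exponents]
      have h2 : exponents i (m - i) 2 = m - i := by simp [exponents]
      rw [if_pos ⟨h1, by omega⟩, h0]
    · intro i _ j _ hij
      simpa [exponents] using DFunLike.congr_fun hij 0
  · intro d hd
    rw [Function.mem_support, ne_eq, ite_eq_right_iff, Classical.not_imp] at hd
    obtain ⟨⟨h1, h2⟩, -⟩ := hd
    rw [Finset.coe_image]
    refine ⟨d 0, by simp; omega, ?_⟩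
    beta_reduce
    rw [← h2, Nat.add_sub_cancel_left]
    exact (eq_exponents h1).symm

/-- The homogeneous functional equation `ρ(u) + (u - 1) ρ(u / (u - 1)) = 0` has no nonzero
polynomial solution that vanishes at `0`. -/
theorem Polynomial.eq_zero_of_involution_eq (ρ : Polynomial ℝ) (h0 : ρ.eval 0 = 0)
    (h : ∀ u : ℝ, 2 < u → ρ.eval u + (u - 1) * ρ.eval (u / (u - 1)) = 0) : ρ = 0 := by
  -- As `u → ∞` the argument `u / (u - 1)` tends to `1`, so `|ρ(u) / (u - 1)|` tends to `|ρ(1)|`,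
  -- which is impossible in degree above `1`.
  have hdeg : ρ.degree ≤ 1 := by
    by_contra! hd
    have hX : (Polynomial.X - Polynomial.C (1 : ℝ)) ≠ 0 := Polynomial.X_sub_C_ne_zero 1
    have h1 := Polynomial.abs_div_tendsto_atTop_atTop_of_degree_gt ρ
      (Polynomial.X - Polynomial.C (1 : ℝ)) (by rwa [Polynomial.degree_X_sub_C]) hX
    have hlim : Filter.Tendsto (fun u : ℝ => 1 + (u - 1)⁻¹) Filter.atTop (nhds (1 + 0)) :=
      tendsto_const_nhds.add
        (tendsto_inv_atTop_zero.comp (Filter.tendsto_atTop_add_const_right _ (-1) Filter.tendsto_id))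
    have h2 : Filter.Tendsto (fun u : ℝ => |ρ.eval (1 + (u - 1)⁻¹)|) Filter.atTop
        (nhds |ρ.eval (1 + 0)|) :=
      ((continuous_abs.comp ρ.continuous).tendsto _).comp hlim
    refine not_tendsto_nhds_of_tendsto_atTop (h1.congr' ?_) _ h2
    filter_upwards [Filter.eventually_gt_atTop (2 : ℝ)] with u hu
    have hu1 : u - 1 ≠ 0 := by linarith
    have := h u hu
    rw [show 1 + (u - 1)⁻¹ = u / (u - 1) by field_simp; ring]
    simp only [Polynomial.eval_sub, Polynomial.eval_X, Polynomial.eval_C]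
    rw [← abs_neg (Polynomial.eval (u / (u - 1)) ρ)]
    congr 1
    rw [div_eq_iff hu1]
    linarith
  rw [Polynomial.eq_X_add_C_of_degree_le_one hdeg] at h0 h ⊢
  simp only [Polynomial.eval_add, Polynomial.eval_mul, Polynomial.eval_C, Polynomial.eval_X,
    mul_zero, zero_add] at h0 h
  have h3 := h 3 (by norm_num)
  -- For `ρ = a u` both terms of the equation equal `a u`, so it says `2 a u = 0`.
  rw [h0] at h3 ⊢
  have : ρ.coeff 1 = 0 := by linarith
  rw [this]
  simp

/-- Uniqueness in the kernel method. -/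
theorem coeff_eq_zero_of_kernel (f : MvPowerSeries (Fin 3) ℝ) (h0 : evalT 0 0 f = 0)
    (hf : ∀ u : ℝ, 2 < u → ∃ v : PowerSeries ℝ, PowerSeries.constantCoeff v = u / (u - 1) ∧
      v * evalT (PowerSeries.C u) 0 f + PowerSeries.C u * evalT v 0 f = 0) (m : ℕ) :
    ∀ i n, i + n = m → MvPowerSeries.coeff (exponents i n) f = 0 := by
  induction m using Nat.strong_induction_on with
  | _ m ih =>
  have low : ∀ i n, i + n < m → MvPowerSeries.coeff (exponents i n) f = 0 :=
    fun i n hin => ih _ hin i n rfl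
  -- `ρ` is the dehomogenized part of degree `m` of `f(x, 0, t)`, the lowest that may be nonzero.
  -- Dividing the relation by `t ^ m` and setting `t = 0` gives the functional equation for `ρ`.
  set ρ : Polynomial ℝ := ∑ i ∈ Finset.range (m + 1),
    Polynomial.monomial i (MvPowerSeries.coeff (exponents i (m - i)) f) with hρ
  have hev : ∀ a : PowerSeries ℝ, PowerSeries.coeff m (evalT a 0 f)
      = ρ.eval (PowerSeries.constantCoeff a) := by
    intro a
    rw [coeff_evalT_zero f m low, hρ, Polynomial.eval_finsetSum]
    simp only [Polynomial.eval_monomial]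
  have hdvd : ∀ a : PowerSeries ℝ, ∃ g, evalT a 0 f = PowerSeries.X ^ m * g := by
    intro a
    apply PowerSeries.X_pow_dvd_iff.mpr
    intro k hk
    rw [coeff_evalT_zero f k fun i n hin => low i n (hin.trans hk)]
    refine Finset.sum_eq_zero fun i hi => ?_
    rw [ih k hk i (k - i) (by have := Finset.mem_range.mp hi; omega), zero_mul]
  have hzero : ρ = 0 := by
    apply Polynomial.eq_zero_of_involution_eq
    · rw [← map_zero (PowerSeries.constantCoeff (R := ℝ)), ← hev, h0, map_zero, map_zero]
    · intro u hu
      obtain ⟨v, hv, h⟩ := hf u hu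
      obtain ⟨g₁, hg₁⟩ := hdvd (PowerSeries.C u)
      obtain ⟨g₂, hg₂⟩ := hdvd v
      have e₁ := hev (PowerSeries.C u)
      have e₂ := hev v
      rw [hg₁, PowerSeries.coeff_X_pow_mul', if_pos le_rfl, Nat.sub_self,
        PowerSeries.coeff_zero_eq_constantCoeff, PowerSeries.constantCoeff_C] at e₁
      rw [hg₂, PowerSeries.coeff_X_pow_mul', if_pos le_rfl, Nat.sub_self,
        PowerSeries.coeff_zero_eq_constantCoeff, hv] at e₂
      rw [hg₁, hg₂] at h
      have h' : v * g₁ + PowerSeries.C u * g₂ = 0 := by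
        apply mul_left_cancel₀ (pow_ne_zero m (PowerSeries.X_ne_zero (R := ℝ)))
        linear_combination h
      have h'' := congrArg PowerSeries.constantCoeff h'
      simp only [map_add, map_mul, map_zero, hv, PowerSeries.constantCoeff_C] at h''
      rw [← e₁, ← e₂]
      have hu0 : u ≠ 0 := by linarith
      have hu1 : u - 1 ≠ 0 := by linarith
      field_simp at h''
      simpa [hu0] using h''
  intro i n hin
  have := congrArg (fun q => Polynomial.coeff q i) hzero
  simp only [hρ, Polynomial.finsetSum_coeff, Polynomial.coeff_monomial, Polynomial.coeff_zero] at this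
  rw [Finset.sum_ite_eq' , if_pos (by simp; omega)] at this
  rwa [show n = m - i by omega]

/-! ### Identities on the kernel curve -/

section Algebra

variable {A : Type*} [CommRing A] [IsDomain A]

/-- Decoupling of the kernel equation on the curve `U v = U + v + p² r t³ U² v²`. -/
theorem decoupled_of_kernel {P R k T U v F G : A} (hK : U * v = U + v + P ^ 2 * R * T * U ^ 2 * v ^ 2)
    (hE : (1 - P * v) * U * F + (1 - P * U) * v * G = R * U * v) (hk : 2 * P * k = R)
    (hP : P ≠ 0) (hU : U ≠ 0) (hv : 1 - P * v ≠ 0) :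
    v * ((1 - (1 - P) * U + P * R * T * U ^ 2) * F - k * ((1 - P) * U - 2))
      + U * ((1 - (1 - P) * v + P * R * T * v ^ 2) * G - k * ((1 - P) * v - 2)) = 0 := by
  -- With `K(U) = 1 - (1 - P) U + P R T U²`, the quantity `(1 - P U) K(U) / U²` takes the same value
  -- at `U` and `v` on the curve. Multiplying `hE` by `v K(U)` thus turns the coefficient of `G`
  -- into one divisible by `1 - P v`, as that of `F` is.
  apply mul_left_cancel₀ (mul_ne_zero hP (mul_ne_zero hU hv))
  linear_combination P * v * (1 - (1 - P) * U + P * R * T * U ^ 2) * hE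
    + (P * G * (v - U) - R * U) * hK - ((1 - P) * U * v - U - v) * U * (1 - P * v) * hk

/-- Invariance on the curve `U v = U + v + c t³ U² v²`. -/
theorem sq_eq_sq_of_kernel {c T U v Z e₁ e₂ : A} (hK : U * v = U + v + c * T * U ^ 2 * v ^ 2)
    (hZ : Z = 1 + 4 * c * T * Z ^ 3) (hZ0 : Z ≠ 0) (h₁ : e₁ ^ 2 = 1 - 4 * c * T * Z ^ 2 * U)
    (h₂ : e₂ ^ 2 = 1 - 4 * c * T * Z ^ 2 * v) :
    (v * ((2 * Z - U) * e₁)) ^ 2 = (U * ((2 * Z - v) * e₂)) ^ 2 := by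
  -- By `hZ`, `(2Z - U)² (1 - 4cTZ²U) / U² = 4Z² (1/U² - 1/U - cTU) + 4Z - 3`, and the bracket is
  -- unchanged when `U` is replaced by `v`.
  apply mul_left_cancel₀ hZ0
  linear_combination Z * v ^ 2 * (2 * Z - U) ^ 2 * h₁ - Z * U ^ 2 * (2 * Z - v) ^ 2 * h₂
    - 4 * Z ^ 3 * (v - U) * hK
    + (v ^ 2 * U * (2 * Z - U) ^ 2 - U ^ 2 * v * (2 * Z - v) ^ 2 + (v - U) * U ^ 2 * v ^ 2) * hZ

/-- The square of the value of the unknown constant. -/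
theorem constant_sq_eq {P R k T W Z e γ : A} (hW : 1 - (1 - P) * W + P * R * T * W ^ 2 = 0)
    (hZ : Z = 1 + 4 * (P ^ 2 * R) * T * Z ^ 3) (h : e ^ 2 = 1 - 4 * (P ^ 2 * R) * T * Z ^ 2 * W)
    (hk : 2 * P * k = R) (hγ : -(2 * Z * (k * ((1 - P) * W - 2))) = γ * ((2 * Z - W) * e))
    (hP : P ≠ 0) (hZ0 : Z ≠ 0) (hne : (2 * Z - W) * e ≠ 0) :
    (P * γ * (1 - 2 * P * Z)) ^ 2 = R ^ 2 * (1 - P * Z * (1 + Z) + P ^ 2 * Z ^ 2) := by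
  have key : (2 - (1 - P) * W) ^ 2 * Z ^ 2 * (1 - 2 * P * Z) ^ 2
      = (1 - P * Z * (1 + Z) + P ^ 2 * Z ^ 2) * ((2 * Z - W) * e) ^ 2 := by
    -- Elimination of `R T` between the equations of `W` and `Z`.
    have hR : 4 * P * Z ^ 3 * (1 - (1 - P) * W) + (Z - 1) * W ^ 2 = 0 := by
      linear_combination 4 * P * Z ^ 3 * hW + W ^ 2 * hZ
    apply mul_left_cancel₀ (mul_ne_zero hP hZ0)
    linear_combination ((1 - 2 * P * Z) ^ 2 - (1 - P * Z * (1 + Z) + P ^ 2 * Z ^ 2) * (1 - P * W)) * hR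
      - P * Z * (1 - P * Z * (1 + Z) + P ^ 2 * Z ^ 2) * (2 * Z - W) ^ 2 * h
      - P * W * (1 - P * Z * (1 + Z) + P ^ 2 * Z ^ 2) * (2 * Z - W) ^ 2 * hZ
  apply mul_left_cancel₀ (pow_ne_zero 2 hne)
  have h2 : (P * γ * ((2 * Z - W) * e)) ^ 2 = R ^ 2 * ((2 - (1 - P) * W) ^ 2 * Z ^ 2) := by
    rw [mul_assoc, ← hγ, ← hk]
    ring
  linear_combination (1 - 2 * P * Z) ^ 2 * h2 + R ^ 2 * key

end Algebra

/-- A quadratic equation with a simple root at `t = 0`. -/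
theorem exists_root_of_quadratic (α β γ : ℝ) (k : ℕ) (hβ : β ≠ 0) :
    ∃ f : PowerSeries ℝ, PowerSeries.constantCoeff f = γ / β ∧
      PowerSeries.C β * f = PowerSeries.C γ
        + PowerSeries.C α * PowerSeries.X ^ (k + 1) * f ^ 2 := by
  obtain ⟨f, hf⟩ := PowerSeries.exists_fixedPoint (fun f : PowerSeries ℝ => PowerSeries.C (γ / β)
    + PowerSeries.C (α / β) * PowerSeries.X ^ (k + 1) * f ^ 2) (by
      intro n f g hfg
      refine (mul_dvd_mul hfg (dvd_refl PowerSeries.X)).trans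
        ⟨PowerSeries.C (α / β) * PowerSeries.X ^ k * (f + g), ?_⟩
      ring)
  have hc : PowerSeries.constantCoeff f = γ / β := by
    rw [← hf]
    simp
  refine ⟨f, hc, ?_⟩
  have hb : PowerSeries.C β * PowerSeries.C (γ / β) = PowerSeries.C γ := by
    rw [← map_mul, mul_div_cancel₀ _ hβ]
  have hb' : PowerSeries.C β * PowerSeries.C (α / β) = PowerSeries.C α := by
    rw [← map_mul, mul_div_cancel₀ _ hβ]
  linear_combination -PowerSeries.C β * hf + hb + PowerSeries.X ^ (k + 1) * f ^ 2 * hb'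

/-! ### Solution of the symmetric case -/

namespace QuadrantWalk

variable (w : QuadrantWalk)

theorem isZ_unique {Z Z' : PowerSeries ℝ} (h : w.IsZ Z) (h' : w.IsZ Z') : Z = Z' := by
  unfold IsZ at h h'
  set c := PowerSeries.C (4 * w.p * w.q * w.r)
  have hne : (1 - c * PowerSeries.X ^ 3 * (Z ^ 2 + Z * Z' + Z' ^ 2)) ≠ 0 := by
    intro h0
    simpa using congrArg PowerSeries.constantCoeff h0
  apply sub_eq_zero.mp ((mul_eq_zero.mp ?_).resolve_right hne)
  linear_combination h - h'

theorem existsUnique_isZ : ∃! Z, w.IsZ Z := by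
  refine existsUnique_of_exists_of_unique ?_ fun Z Z' => w.isZ_unique
  obtain ⟨Z, hZ⟩ := PowerSeries.exists_fixedPoint (fun Z : PowerSeries ℝ => 1
    + PowerSeries.C (4 * w.p * w.q * w.r) * PowerSeries.X ^ 3 * Z ^ 3) (by
      intro n f g hfg
      refine (mul_dvd_mul hfg (dvd_refl PowerSeries.X)).trans
        ⟨PowerSeries.C (4 * w.p * w.q * w.r) * PowerSeries.X ^ 2 * (f ^ 2 + f * g + g ^ 2), ?_⟩
      ring)
  exact ⟨Z, hZ.symm⟩

theorem constantCoeff_of_isZ {Z : PowerSeries ℝ} (h : w.IsZ Z) :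
    PowerSeries.constantCoeff Z = 1 := by
  unfold IsZ at h
  rw [h]
  simp

/-- The series `√Δ₊(x)`. -/
noncomputable def eta (Z : PowerSeries ℝ) : MvPowerSeries (Fin 3) ℝ :=
  PowerSeries.subst (-(const3 (4 * w.p * w.q * w.r) * tVar ^ 2 * inT Z ^ 2 * xVar)) sqrtOneAdd

theorem constantCoeff_eta_arg (Z : PowerSeries ℝ) : MvPowerSeries.constantCoeff
    (-(const3 (4 * w.p * w.q * w.r) * tVar ^ 2 * inT Z ^ 2 * xVar)) = 0 := by simp

theorem eta_sq (Z : PowerSeries ℝ) : w.eta Z ^ 2 = w.deltaPlus Z := by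
  have hs := PowerSeries.HasSubst.of_constantCoeff_zero (w.constantCoeff_eta_arg Z)
  have h := congrArg (PowerSeries.substAlgHom (R := ℝ) hs) sqrtOneAdd_sq
  rw [map_pow, map_add, map_one, PowerSeries.coe_substAlgHom, PowerSeries.subst_X hs] at h
  rw [eta, h, deltaPlus]
  ring

theorem constantCoeff_eta (Z : PowerSeries ℝ) : MvPowerSeries.constantCoeff (w.eta Z) = 1 := by
  rw [eta, constantCoeff_powerSeries_subst (w.constantCoeff_eta_arg Z), constantCoeff_sqrtOneAdd]

theorem substHom_eta (Z : PowerSeries ℝ) :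
    substHom xVar 0 tVar (MvPowerSeries.constantCoeff_X 0) (map_zero _)
      (MvPowerSeries.constantCoeff_X 2) (w.eta Z) = w.eta Z := by
  rw [eta, substHom_subst _ _ _ (w.constantCoeff_eta_arg Z)]
  simp only [map_neg, map_mul, map_pow, substHom_const3, substHom_tVar, substHom_inT,
    substHom_xVar]
  rfl

theorem substHom_Qpx : substHom xVar 0 tVar (MvPowerSeries.constantCoeff_X 0) (map_zero _)
      (MvPowerSeries.constantCoeff_X 2) w.Qpx = w.Qpx := by
  rw [Qpx, substHom_substHom]
  simp only [map_mul, map_zero, substHom_xVar, substHom_tVar, substHom_const3]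

theorem evalT_Qpx (a b : PowerSeries ℝ) : evalT a b w.Qpx = evalT a 0 w.Qpx := by
  have h : ∀ b, evalT a b w.Qpx = evalT (PowerSeries.C w.p * a) 0 w.Qx := by
    intro b
    apply evalT_substHom
    · rw [map_mul, evalT_const3, evalT_xVar]
      ring
    · rw [map_zero, mul_zero]
  rw [h, h]

theorem evalT_zero_Qpx : evalT 0 0 w.Qpx = w.P00 := by
  have h := congrArg (evalT 0 0) w.evalXY_Qpx_zero
  rw [evalT_inT, evalXY_eq_substHom _ (map_zero _) (map_zero _)] at h
  rw [← h]
  symm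
  apply evalT_substHom <;> simp

theorem evalT_Qpy (hα : w.p / w.r = w.p₁ / w.r₁) (hβ : w.q / w.r = w.q₂ / w.r₂)
    (hpq : w.p = w.q) (a b : PowerSeries ℝ) : evalT a b w.Qpy = evalT b 0 w.Qpx := by
  rw [w.Qpy_eq_evalXY hα hβ hpq,
    evalXY_eq_substHom _ (MvPowerSeries.constantCoeff_X 1) (map_zero _)]
  apply evalT_substHom
  · exact evalT_yVar a b
  · rw [map_zero, mul_zero]

/-- At `x = t a`, `y = t b` the kernel is `t²` times the curve equation, so `Q(px, py)` drops out;
symmetry replaces `Q(0, py)` by the series `Q(px, 0)` evaluated at `b`. -/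
theorem kernel_equation (hα : w.p / w.r = w.p₁ / w.r₁) (hβ : w.q / w.r = w.q₂ / w.r₂)
    (hpq : w.p = w.q) {a b : PowerSeries ℝ}
    (hK : a * b = a + b + PowerSeries.C w.p ^ 2 * PowerSeries.C w.r * PowerSeries.X ^ 3
      * a ^ 2 * b ^ 2) :
    (1 - PowerSeries.C w.p * b) * a * evalT a 0 w.Qpx
      + (1 - PowerSeries.C w.p * a) * b * evalT b 0 w.Qpx = PowerSeries.C w.r * a * b := by
  have h := congrArg (evalT a b) (w.functional_equation_symm hα hβ hpq)
  simp only [map_mul, map_sub, map_add, map_pow, evalT_xVar, evalT_yVar, evalT_tVar,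
    evalT_const3, w.evalT_Qpy hα hβ hpq, ← hpq] at h
  rw [w.evalT_Qpx a b] at h
  apply mul_left_cancel₀ (pow_ne_zero 2 (PowerSeries.X_ne_zero (R := ℝ)))
  linear_combination h - PowerSeries.X ^ 2 * evalT a b w.Qpxy * hK

end QuadrantWalk

theorem eq_of_sq_eq_sq_of_constantCoeff_pos {f g : PowerSeries ℝ} (h : f ^ 2 = g ^ 2)
    (hf : 0 < PowerSeries.constantCoeff f) (hg : 0 < PowerSeries.constantCoeff g) : f = g := by
  rcases sq_eq_sq_iff_eq_or_eq_neg.mp h with h | h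
  · exact h
  · rw [h, map_neg] at hf
    linarith

namespace QuadrantWalk

variable (w : QuadrantWalk)

/-- The polynomial `t - x(1-p) + p r x² t²`. -/
noncomputable def axisKernel : MvPowerSeries (Fin 3) ℝ :=
  tVar - const3 (1 - w.p) * xVar + const3 (w.p * w.r) * xVar ^ 2 * tVar ^ 2

theorem two_mul_p_mul_C : 2 * PowerSeries.C w.p * PowerSeries.C (w.r / (2 * w.p))
    = PowerSeries.C w.r := by
  rw [← map_ofNat (PowerSeries.C (R := ℝ)) 2, ← map_mul, ← map_mul]
  congr 1
  have := w.p_pos.ne'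
  field_simp

theorem isZ_symm (hpq : w.p = w.q) {Z : PowerSeries ℝ} (hZ : w.IsZ Z) :
    Z = 1 + 4 * (PowerSeries.C w.p ^ 2 * PowerSeries.C w.r) * PowerSeries.X ^ 3 * Z ^ 3 := by
  have h := hZ
  unfold IsZ at h
  rw [← hpq, map_mul, map_mul, map_mul, map_ofNat] at h
  linear_combination h

theorem evalT_eta_sq (hpq : w.p = w.q) (Z a : PowerSeries ℝ) : evalT a 0 (w.eta Z) ^ 2
    = 1 - 4 * (PowerSeries.C w.p ^ 2 * PowerSeries.C w.r) * PowerSeries.X ^ 3 * Z ^ 2 * a := by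
  rw [← map_pow, eta_sq, deltaPlus]
  simp only [map_mul, map_sub, map_pow, map_one, evalT_xVar, evalT_tVar, evalT_const3, evalT_inT,
    ← hpq, map_ofNat]
  ring

theorem constantCoeff_evalT_eta (Z a : PowerSeries ℝ) :
    PowerSeries.constantCoeff (evalT a 0 (w.eta Z)) = 1 := by
  rw [constantCoeff_evalT, constantCoeff_eta]

theorem evalT_eta_zero (hpq : w.p = w.q) (Z : PowerSeries ℝ) : evalT 0 0 (w.eta Z) = 1 := by
  apply eq_of_sq_eq_sq_of_constantCoeff_pos
  · rw [w.evalT_eta_sq hpq, mul_zero, sub_zero, one_pow]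
  · rw [constantCoeff_evalT_eta]; exact one_pos
  · simp

/-- The series whose vanishing expresses `Q(px, 0)` in terms of `P_{0,0}`. -/
noncomputable def defect (Z : PowerSeries ℝ) : MvPowerSeries (Fin 3) ℝ :=
  2 * inT Z * (w.axisKernel * w.Qpx
      - const3 (w.r / (2 * w.p)) * (const3 (1 - w.p) * xVar - 2 * tVar))
    - inT (w.P00 + PowerSeries.C (w.r / w.p)) * ((2 * tVar * inT Z - xVar) * w.eta Z)

theorem evalT_defect (Z a : PowerSeries ℝ) : evalT a 0 (w.defect Z) = PowerSeries.X *
    (2 * Z * ((1 - (1 - PowerSeries.C w.p) * a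
          + PowerSeries.C w.p * PowerSeries.C w.r * PowerSeries.X ^ 3 * a ^ 2) * evalT a 0 w.Qpx
        - PowerSeries.C (w.r / (2 * w.p)) * ((1 - PowerSeries.C w.p) * a - 2))
      - (w.P00 + PowerSeries.C (w.r / w.p)) * ((2 * Z - a) * evalT a 0 (w.eta Z))) := by
  rw [defect, axisKernel]
  simp only [map_mul, map_sub, map_add, map_pow, evalT_xVar, evalT_tVar, evalT_const3, evalT_inT,
    map_one, map_ofNat]
  ring

theorem p_lt_half (hpq : w.p = w.q) : 2 * w.p < 1 := by
  linarith [w.sum_interior, w.r_pos]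

theorem evalT_defect_antisymm (hα : w.p / w.r = w.p₁ / w.r₁) (hβ : w.q / w.r = w.q₂ / w.r₂)
    (hpq : w.p = w.q) {Z : PowerSeries ℝ} (hZ : w.IsZ Z) (u : ℝ) (hu : 2 < u) :
    ∃ v : PowerSeries ℝ, PowerSeries.constantCoeff v = u / (u - 1) ∧
      v * evalT (PowerSeries.C u) 0 (w.defect Z)
        + PowerSeries.C u * evalT v 0 (w.defect Z) = 0 := by
  have hu1 : u - 1 ≠ 0 := by linarith
  have hu0 : u ≠ 0 := by linarith
  -- The curve equation solved for `v`: `(u - 1) v = u + p² r u² t³ v²`.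
  obtain ⟨v, hv, hK'⟩ := exists_root_of_quadratic (w.p ^ 2 * w.r * u ^ 2) (u - 1) u 2 hu1
  refine ⟨v, hv, ?_⟩
  have hK : PowerSeries.C u * v = PowerSeries.C u + v + PowerSeries.C w.p ^ 2 * PowerSeries.C w.r
      * PowerSeries.X ^ 3 * PowerSeries.C u ^ 2 * v ^ 2 := by
    simp only [map_mul, map_sub, map_one, map_pow] at hK'
    linear_combination hK'
  have hC : ∀ {c : ℝ}, c ≠ 0 → PowerSeries.C c ≠ 0 := fun h h' =>
    h (by simpa using congrArg PowerSeries.constantCoeff h')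
  -- Since `u > 2`, the constant term of `v` is below `2`, while `p < 1/2`.
  have hne : 1 - PowerSeries.C w.p * v ≠ 0 := by
    intro h
    have := congrArg PowerSeries.constantCoeff h
    simp only [map_sub, map_mul, map_one, map_zero, hv, PowerSeries.constantCoeff_C] at this
    have hp := w.p_lt_half hpq
    field_simp at this
    nlinarith [w.p_pos]
  have hZ1 := w.constantCoeff_of_isZ hZ
  have hZ0 : Z ≠ 0 := by
    rintro rfl
    simp at hZ1
  have h₁ := decoupled_of_kernel hK (w.kernel_equation hα hβ hpq hK) w.two_mul_p_mul_C
    (hC w.p_pos.ne') (hC hu0) hne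
  have h₂ := sq_eq_sq_of_kernel hK (w.isZ_symm hpq hZ) hZ0
    (w.evalT_eta_sq hpq Z (PowerSeries.C u)) (w.evalT_eta_sq hpq Z v)
  have h₃ : v * ((2 * Z - PowerSeries.C u) * evalT (PowerSeries.C u) 0 (w.eta Z))
      = -(PowerSeries.C u * ((2 * Z - v) * evalT v 0 (w.eta Z))) := by
    -- At `t = 0` the two sides before signs are `u (2 - u) / (u - 1)` and its opposite, nonzero for
    -- `u > 2`; the plus sign is excluded.
    refine (sq_eq_sq_iff_eq_or_eq_neg.mp h₂).resolve_left fun h => ?_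
    have := congrArg PowerSeries.constantCoeff h
    simp only [map_mul, map_sub, map_ofNat, hZ1, hv, constantCoeff_evalT_eta,
      PowerSeries.constantCoeff_C] at this
    field_simp at this
    nlinarith
  rw [evalT_defect, evalT_defect]
  linear_combination PowerSeries.X * (2 * Z * h₁) - PowerSeries.X
    * (w.P00 + PowerSeries.C (w.r / w.p)) * h₃

theorem defect_eq_zero (hα : w.p / w.r = w.p₁ / w.r₁) (hβ : w.q / w.r = w.q₂ / w.r₂)
    (hpq : w.p = w.q) {Z : PowerSeries ℝ} (hZ : w.IsZ Z) : w.defect Z = 0 := by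
  -- At `x = 0` both parts reduce to `2tZ (P₀₀ + r/p)`; this is what dictates the factor `P₀₀ + r/p`
  -- in `defect`.
  have h0 : evalT 0 0 (w.defect Z) = 0 := by
    rw [evalT_defect, evalT_zero_Qpx, w.evalT_eta_zero hpq]
    have h : 2 * PowerSeries.C (w.r / (2 * w.p)) = PowerSeries.C (w.r / w.p) := by
      rw [← map_ofNat (PowerSeries.C (R := ℝ)) 2, ← map_mul]
      congr 1
      have := w.p_pos.ne'
      field_simp
    linear_combination PowerSeries.X * 2 * Z * h
  have hcoeff := coeff_eq_zero_of_kernel (w.defect Z) h0 (w.evalT_defect_antisymm hα hβ hpq hZ)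
  -- The defect does not involve `y`, so its coefficients without `y` determine it.
  have hself : substHom xVar 0 tVar (MvPowerSeries.constantCoeff_X 0) (map_zero _)
      (MvPowerSeries.constantCoeff_X 2) (w.defect Z) = w.defect Z := by
    rw [defect, axisKernel]
    simp only [map_mul, map_sub, map_add, map_pow, substHom_xVar, substHom_tVar, substHom_const3,
      substHom_Qpx, substHom_eta, map_ofNat, substHom_inT]
    rfl
  rw [← hself]
  refine (substHom_congr_of_coeff_zero _ _ _ (g := 0) fun d hd => ?_).trans (map_zero _)
  rw [eq_exponents hd, hcoeff _ _ _ rfl, map_zero]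

/-- The polynomial `Δ₋(p/t)` in `Z`. -/
noncomputable def deltaMinusP (Z : PowerSeries ℝ) : PowerSeries ℝ :=
  1 - PowerSeries.C w.p * Z * (1 + Z) + PowerSeries.C (w.p ^ 2) * Z ^ 2

theorem exists_sqrt_deltaMinusP (hpq : w.p = w.q) {Z : PowerSeries ℝ} (hZ : w.IsZ Z) :
    ∃ δ : PowerSeries ℝ, IsSeriesSqrt δ (w.deltaMinusP Z) := by
  have hZ1 := w.constantCoeff_of_isZ hZ
  have hp := w.p_lt_half hpq
  have hne : (1 - w.p) ≠ 0 := by linarith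
  -- At `Z = 1` the polynomial equals `(1 - p)²`; after division by it the binomial series applies.
  have hc : PowerSeries.constantCoeff
      (PowerSeries.C ((1 - w.p) ^ 2)⁻¹ * w.deltaMinusP Z - 1) = 0 := by
    simp only [deltaMinusP, map_sub, map_mul, map_add, map_one, map_pow, hZ1,
      PowerSeries.constantCoeff_C]
    field_simp
    ring
  have hs := PowerSeries.HasSubst.of_constantCoeff_zero' hc
  have h := congrArg (PowerSeries.substAlgHom (R := ℝ) hs) sqrtOneAdd_sq
  rw [map_pow, map_add, map_one, PowerSeries.coe_substAlgHom, PowerSeries.subst_X hs] at h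
  refine ⟨PowerSeries.C (1 - w.p) * PowerSeries.subst
    (PowerSeries.C ((1 - w.p) ^ 2)⁻¹ * w.deltaMinusP Z - 1) sqrtOneAdd, ?_, ?_⟩
  · rw [mul_pow, h]
    have : PowerSeries.C (1 - w.p) ^ 2 * PowerSeries.C ((1 - w.p) ^ 2)⁻¹ = 1 := by
      rw [← map_pow, ← map_mul, mul_inv_cancel₀ (pow_ne_zero 2 hne), map_one]
    linear_combination w.deltaMinusP Z * this
  · rw [map_mul]
    have := constantCoeff_powerSeries_subst hc sqrtOneAdd
    rw [this, constantCoeff_sqrtOneAdd, mul_one]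
    change 0 < PowerSeries.constantCoeff (PowerSeries.C (1 - w.p))
    rw [PowerSeries.constantCoeff_C]
    linarith

theorem constantCoeff_P00 : PowerSeries.constantCoeff w.P00 = 1 := by
  rw [← PowerSeries.coeff_zero_eq_constantCoeff_apply, P00, PowerSeries.coeff_mk]
  rfl

theorem P00_add_mul (hα : w.p / w.r = w.p₁ / w.r₁) (hβ : w.q / w.r = w.q₂ / w.r₂)
    (hpq : w.p = w.q) {Z δ : PowerSeries ℝ} (hZ : w.IsZ Z)
    (hδ : IsSeriesSqrt δ (w.deltaMinusP Z)) :
    (w.P00 + PowerSeries.C (w.r / w.p)) * (1 - PowerSeries.C (2 * w.p) * Z)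
      = PowerSeries.C (w.r / w.p) * δ := by
  have hp := w.p_lt_half hpq
  have hne : (1 - w.p) ≠ 0 := by linarith
  have hZ1 := w.constantCoeff_of_isZ hZ
  have hZ0 : Z ≠ 0 := by
    rintro rfl
    simp at hZ1
  have hP0 : PowerSeries.C w.p ≠ 0 := fun h =>
    w.p_pos.ne' (by simpa using congrArg PowerSeries.constantCoeff h)
  -- `W` is the power series root of the factor multiplying `Q(px, 0)`, so the vanishing defect
  -- becomes an equation for `P₀₀ + r/p` alone.
  obtain ⟨W, hW1, hW'⟩ := exists_root_of_quadratic (w.p * w.r) (1 - w.p) 1 2 hne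
  have hW : 1 - (1 - PowerSeries.C w.p) * W
      + PowerSeries.C w.p * PowerSeries.C w.r * PowerSeries.X ^ 3 * W ^ 2 = 0 := by
    simp only [map_mul, map_sub, map_one] at hW'
    linear_combination -hW'
  have hγ := w.evalT_defect Z W
  rw [w.defect_eq_zero hα hβ hpq hZ, map_zero, hW, zero_mul, zero_sub] at hγ
  have hγ' := (mul_eq_zero.mp hγ.symm).resolve_left PowerSeries.X_ne_zero
  have hsq := constant_sq_eq hW (w.isZ_symm hpq hZ) (w.evalT_eta_sq hpq Z W) w.two_mul_p_mul_C
    (γ := w.P00 + PowerSeries.C (w.r / w.p)) (by linear_combination hγ') hP0 hZ0 (by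
      intro h
      have := congrArg PowerSeries.constantCoeff h
      simp only [map_mul, map_sub, map_ofNat, hZ1, hW1, constantCoeff_evalT_eta, map_zero] at this
      field_simp at this
      linarith)
  have hr : PowerSeries.C w.p * PowerSeries.C (w.r / w.p) = PowerSeries.C w.r := by
    rw [← map_mul, mul_div_cancel₀ _ w.p_pos.ne']
  have h2 : PowerSeries.C (2 * w.p) = 2 * PowerSeries.C w.p := by
    rw [map_mul, map_ofNat]
  have hrp : 0 < w.r / w.p := div_pos w.r_pos w.p_pos
  apply eq_of_sq_eq_sq_of_constantCoeff_pos
  · apply mul_left_cancel₀ (pow_ne_zero 2 hP0)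
    have hd : δ ^ 2 = 1 - PowerSeries.C w.p * Z * (1 + Z) + PowerSeries.C w.p ^ 2 * Z ^ 2 := by
      rw [← map_pow]
      exact hδ.1
    rw [← hd, ← hr, ← h2] at hsq
    linear_combination hsq
  · simp only [map_mul, map_add, map_sub, map_one, constantCoeff_P00, hZ1,
      PowerSeries.constantCoeff_C]
    apply mul_pos <;> linarith
  · rw [map_mul, PowerSeries.constantCoeff_C]
    exact mul_pos hrp hδ.2

end QuadrantWalk

/-! ### The degree of `P₀₀` -/

open IntermediateField in
/-- A quadratic extension of a cubic extension `K(z)`, generated over `K` by a square root `g` of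
an element of `K(z)` not in `K`. -/
theorem natDegree_minpoly_eq_six {K L : Type*} [Field K] [Field L] [Algebra K L] {z g : L}
    (hz : (minpoly K z).natDegree = 3) (hg2 : g ^ 2 ∈ K⟮z⟯) (hg : g ∉ K⟮z⟯)
    (hn : g ^ 2 ∉ (⊥ : IntermediateField K L)) : (minpoly K g).natDegree = 6 := by
  have hzi : IsIntegral K z := by
    by_contra h
    rw [minpoly.eq_zero h] at hz
    simp at hz
  have h3 : Module.finrank K K⟮z⟯ = 3 := by rw [adjoin.finrank hzi, hz]
  have hfd : FiniteDimensional K K⟮z⟯ := adjoin.finiteDimensional hzi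
  have hle : K⟮g ^ 2⟯ ≤ K⟮z⟯ := adjoin_simple_le_iff.mpr hg2
  -- The degree `3` is prime and `g ^ 2 ∉ K`, so `g ^ 2` already generates `K(z)`. Hence `z ∈ K(g)`,
  -- and `K(g) = K(z)(g)` has degree `3 · 2`.
  have heq : K⟮g ^ 2⟯ = K⟮z⟯ := by
    apply eq_of_le_of_finrank_eq hle
    have hdvd := finrank_dvd_of_le_right hle
    rw [h3] at hdvd ⊢
    refine ((Nat.dvd_prime Nat.prime_three).mp hdvd).resolve_left fun h1 => hn ?_
    rw [IntermediateField.finrank_eq_one_iff] at h1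
    rw [← h1]
    exact mem_adjoin_simple_self K _
  have hzg : z ∈ K⟮g⟯ := by
    have h1 : K⟮g ^ 2⟯ ≤ K⟮g⟯ :=
      adjoin_simple_le_iff.mpr (pow_mem (mem_adjoin_simple_self K g) 2)
    apply h1
    rw [heq]
    exact mem_adjoin_simple_self K z
  have hroot : Polynomial.aeval g
      (Polynomial.X ^ 2 - Polynomial.C (⟨g ^ 2, hg2⟩ : K⟮z⟯)) = 0 := by
    simp
  have hmonic : (Polynomial.X ^ 2 - Polynomial.C (⟨g ^ 2, hg2⟩ : K⟮z⟯)).Monic :=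
    Polynomial.monic_X_pow_sub_C _ two_ne_zero
  have hgi : IsIntegral K⟮z⟯ g := ⟨_, hmonic, hroot⟩
  have h2 : Module.finrank K⟮z⟯ K⟮z⟯⟮g⟯ = 2 := by
    rw [adjoin.finrank hgi]
    apply le_antisymm
    · have := Polynomial.natDegree_le_of_dvd (minpoly.dvd _ _ hroot) hmonic.ne_zero
      rwa [Polynomial.natDegree_X_pow_sub_C] at this
    · rw [minpoly.two_le_natDegree_iff hgi]
      rintro ⟨y, hy⟩
      exact hg (hy ▸ y.2)
  have h6 : Module.finrank K (K⟮z⟯⟮g⟯.restrictScalars K) = 6 := by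
    have := Module.finrank_mul_finrank K K⟮z⟯ K⟮z⟯⟮g⟯
    rw [h3, h2] at this
    exact this.symm
  have hK : K⟮z⟯⟮g⟯.restrictScalars K = K⟮g⟯ := by
    rw [adjoin_simple_adjoin_simple]
    apply le_antisymm
    · rw [adjoin_le_iff]
      rintro x (rfl | rfl)
      · exact hzg
      · exact mem_adjoin_simple_self K _
    · exact adjoin.mono _ _ _ (by simp)
  rw [hK] at h6
  rw [← h6]
  refine (adjoin.finrank ?_).symm
  have : FiniteDimensional K K⟮g⟯ := Module.finite_of_finrank_pos (by omega)
  have := IsIntegral.of_finite K (⟨g, mem_adjoin_simple_self K g⟩ : K⟮g⟯)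
  exact this.map (K⟮g⟯.val)

/-- The equation `c t³ Z³ - Z + 1 = 0` has no solution in `ℝ(t)`. -/
theorem RatFunc.cubic_no_root {c : ℝ} (hc : c ≠ 0) (x : RatFunc ℝ) :
    RatFunc.C c * RatFunc.X ^ 3 * x ^ 3 - x + 1 ≠ 0 := by
  intro h
  have hx : x ≠ 0 := by
    rintro rfl
    simp at h
  -- The inverse `y = x⁻¹` satisfies the monic equation `y³ - y² + c t³ = 0`, so it is a polynomial,
  -- of degree `1` by `y² (1 - y) = c t³`.
  have hint : IsIntegral (Polynomial ℝ) x⁻¹ := by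
    refine ⟨Polynomial.X ^ 3 - Polynomial.X ^ 2 + Polynomial.C (Polynomial.C c * Polynomial.X ^ 3),
      ?_, ?_⟩
    · monicity!
    · simp only [Polynomial.eval₂_add, Polynomial.eval₂_sub, Polynomial.eval₂_pow,
        Polynomial.eval₂_X, Polynomial.eval₂_C]
      rw [map_mul, map_pow, RatFunc.algebraMap_X, RatFunc.algebraMap_C]
      field_simp
      linear_combination h
  obtain ⟨y, hy⟩ := IsIntegrallyClosed.isIntegral_iff.mp hint
  have hpoly : y ^ 2 * (1 - y) = Polynomial.C c * Polynomial.X ^ 3 := by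
    apply RatFunc.algebraMap_injective ℝ
    simp only [map_mul, map_sub, map_pow, map_one, hy, RatFunc.algebraMap_X, RatFunc.algebraMap_C]
    field_simp
    linear_combination -h
  have hdeg : y.natDegree = 1 := by
    have h1 : (y ^ 2 * (1 - y)).natDegree = 3 := by
      rw [hpoly, Polynomial.natDegree_C_mul_X_pow _ _ hc]
    by_cases h0 : y.natDegree = 0
    · rw [Polynomial.eq_C_of_natDegree_eq_zero h0] at h1
      rw [← Polynomial.C_1, ← Polynomial.C_sub, ← Polynomial.C_pow, ← Polynomial.C_mul,
        Polynomial.natDegree_C] at h1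
      omega
    · have h2 : (1 - y).natDegree = y.natDegree :=
        Polynomial.natDegree_sub_eq_right_of_natDegree_lt (by simpa using Nat.pos_of_ne_zero h0)
      have hy0 : y ≠ 0 := by
        rintro rfl
        simp at h0
      have hy1 : (1 - y) ≠ 0 := by
        intro h'
        rw [h', Polynomial.natDegree_zero] at h2
        omega
      rw [Polynomial.natDegree_mul (pow_ne_zero 2 hy0) hy1, Polynomial.natDegree_pow, h2] at h1
      omega
  rw [Polynomial.eq_X_add_C_of_natDegree_le_one hdeg.le] at hpoly
  have ha : y.coeff 1 ≠ 0 := by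
    rw [← hdeg, Polynomial.coeff_natDegree, ne_eq, Polynomial.leadingCoeff_eq_zero]
    rintro rfl
    simp at hdeg
  set α := y.coeff 1
  set β := y.coeff 0
  have e₀ := congrArg (Polynomial.eval 0) hpoly
  have e₁ := congrArg (Polynomial.eval 1) hpoly
  have e₂ := congrArg (Polynomial.eval (-1)) hpoly
  simp only [Polynomial.eval_mul, Polynomial.eval_pow, Polynomial.eval_add, Polynomial.eval_sub,
    Polynomial.eval_one, Polynomial.eval_C, Polynomial.eval_X] at e₀ e₁ e₂
  -- The coefficient of `t²`; it forces `β = 1/3`, against the constant term `β² (1 - β) = 0`.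
  have e₃ : α ^ 2 * (1 - 3 * β) = 0 := by linear_combination e₁ / 2 + e₂ / 2 - e₀
  have e₄ : 1 - 3 * β = 0 := (mul_eq_zero.mp e₃).resolve_left (pow_ne_zero 2 ha)
  have e₅ : β = 1 / 3 := by linarith
  rw [e₅] at e₀
  norm_num at e₀

theorem algebraMap_polynomial_laurent (f : Polynomial ℝ) :
    algebraMap (RatFunc ℝ) (LaurentSeries ℝ) (algebraMap _ _ f)
      = toLaurent (f : PowerSeries ℝ) := by
  rw [← IsScalarTower.algebraMap_apply]
  rfl

theorem algebraMap_C_laurent (c : ℝ) :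
    algebraMap (RatFunc ℝ) (LaurentSeries ℝ) (RatFunc.C c) = toLaurent (PowerSeries.C c) := by
  rw [← RatFunc.algebraMap_C, algebraMap_polynomial_laurent, Polynomial.coe_C]

theorem algebraMap_X_laurent :
    algebraMap (RatFunc ℝ) (LaurentSeries ℝ) RatFunc.X = toLaurent PowerSeries.X := by
  rw [← RatFunc.algebraMap_X, algebraMap_polynomial_laurent, Polynomial.coe_X]

theorem toLaurent_injective : Function.Injective toLaurent :=
  HahnSeries.ofPowerSeries_injective

/-- A series `t Z` with `Z(0) ≠ 0` is a root of no nonzero real polynomial. -/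
theorem aeval_ne_zero_of_X_mul {Z : PowerSeries ℝ} (hZ : PowerSeries.constantCoeff Z ≠ 0)
    (n : ℕ) : ∀ f : Polynomial ℝ, f.natDegree ≤ n →
      Polynomial.aeval (PowerSeries.X * Z) f = 0 → f = 0 := by
  have hne : PowerSeries.X * Z ≠ 0 := by
    apply mul_ne_zero PowerSeries.X_ne_zero
    rintro rfl
    simp at hZ
  have h0 : ∀ f : Polynomial ℝ, Polynomial.aeval (PowerSeries.X * Z) f = 0 →
      f.divX * Polynomial.X = f ∧ Polynomial.aeval (PowerSeries.X * Z) f.divX = 0 := by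
    intro f hf
    -- `tZ` has no constant term, so that of `f` vanishes and a factor `X` splits off.
    have hc : f.coeff 0 = 0 := by
      have h := congrArg PowerSeries.constantCoeff hf
      rw [← Polynomial.divX_mul_X_add f] at h
      simpa [PowerSeries.algebraMap_apply] using h
    have h := Polynomial.divX_mul_X_add f
    rw [hc, Polynomial.C_0, add_zero] at h
    refine ⟨h, ?_⟩
    rw [← h, map_mul, Polynomial.aeval_X] at hf
    exact (mul_eq_zero.mp hf).resolve_right hne
  induction n with
  | zero =>
    intro f hdeg hf
    rw [Polynomial.eq_C_of_natDegree_le_zero hdeg] at hf ⊢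
    simpa [PowerSeries.algebraMap_apply] using hf
  | succ n ih =>
    intro f hdeg hf
    obtain ⟨h1, h2⟩ := h0 f hf
    rw [← h1, ih f.divX (by rw [Polynomial.natDegree_divX_eq_natDegree_tsub_one]; omega) h2,
      zero_mul]

open IntermediateField in
/-- If `Z = 1 + c (tZ)³`, then `ℝ(t, Z) = ℝ(tZ)`. -/
theorem mem_adjoin_X_mul {Z : PowerSeries ℝ} {c : ℝ} (hZ0 : Z ≠ 0)
    (hZ : Z = 1 + PowerSeries.C c * PowerSeries.X ^ 3 * Z ^ 3) {x : LaurentSeries ℝ}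
    (hx : x ∈ (RatFunc ℝ)⟮toLaurent Z⟯) : x ∈ ℝ⟮toLaurent (PowerSeries.X * Z)⟯ := by
  set F := ℝ⟮toLaurent (PowerSeries.X * Z)⟯
  have hs : toLaurent (PowerSeries.X * Z) ∈ F := mem_adjoin_simple_self ℝ _
  have hC : ∀ a, toLaurent (PowerSeries.C a) ∈ F := fun a => F.algebraMap_mem a
  -- With `s = tZ`, the equation reads `Z = 1 + c s³`; then `t = s / Z`.
  have hzF : toLaurent Z ∈ F := by
    have h := congrArg toLaurent hZ
    rw [mul_assoc, ← mul_pow] at h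
    simp only [toLaurent, map_add, map_one, map_mul, map_pow] at h hs hC ⊢
    rw [h]
    exact add_mem (one_mem _) (mul_mem (hC c) (pow_mem hs 3))
  have hX : toLaurent PowerSeries.X ∈ F := by
    have h := div_mem hs hzF
    have hz0 : toLaurent Z ≠ 0 := fun h => hZ0 (toLaurent_injective (by simpa [toLaurent] using h))
    simp only [toLaurent, map_mul] at h hz0 ⊢
    rwa [mul_div_cancel_right₀ _ hz0] at h
  have hpoly : ∀ f : Polynomial ℝ, toLaurent (f : PowerSeries ℝ) ∈ F := by
    intro f
    induction f using Polynomial.induction_on' with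
    | add f g hf hg =>
      simp only [toLaurent, Polynomial.coe_add, map_add] at hf hg ⊢
      exact add_mem hf hg
    | monomial n a =>
      rw [← Polynomial.C_mul_X_pow_eq_monomial]
      simp only [toLaurent, Polynomial.coe_mul, Polynomial.coe_C, Polynomial.coe_pow,
        Polynomial.coe_X, map_mul, map_pow] at hC hX ⊢
      exact mul_mem (hC a) (pow_mem hX n)
  have hle := adjoin_le_subfield (RatFunc ℝ) {toLaurent Z} (K := F.toSubfield) (by
    rintro _ ⟨f, rfl⟩
    rw [← RatFunc.num_div_denom f, map_div₀, algebraMap_polynomial_laurent,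
      algebraMap_polynomial_laurent]
    exact div_mem (hpoly _) (hpoly _)) (by
    rintro _ rfl
    exact hzF)
  exact hle hx

theorem aeval_toLaurent (σ : PowerSeries ℝ) (f : Polynomial ℝ) :
    Polynomial.aeval (toLaurent σ) f = toLaurent (Polynomial.aeval σ f) := by
  rw [Polynomial.aeval_def, Polynomial.aeval_def, toLaurent, toLaurent, Polynomial.hom_eval₂]
  rfl

/-- A sextic with negative leading coefficient in `s = tZ` is not a square in `ℝ(s)`. -/
theorem not_mem_of_sq_eq {Z δ : PowerSeries ℝ} {c p : ℝ} (hc : c ≠ 0) (hp0 : 0 < p) (hp1 : p < 1)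
    (hZ1 : PowerSeries.constantCoeff Z = 1)
    (hZ : Z = 1 + PowerSeries.C c * PowerSeries.X ^ 3 * Z ^ 3) (hδ0 : δ ≠ 0)
    (hδ : δ ^ 2 = 1 - PowerSeries.C p * Z * (1 + Z) + PowerSeries.C (p ^ 2) * Z ^ 2) :
    toLaurent δ ∉ IntermediateField.adjoin (RatFunc ℝ) {toLaurent Z} := by
  intro hmem
  have hZ0 : Z ≠ 0 := by
    rintro rfl
    simp at hZ1
  obtain ⟨A, B, hAB⟩ := (IntermediateField.mem_adjoin_simple_iff _ _).mp
    (mem_adjoin_X_mul hZ0 hZ hmem)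
  have hd0 : toLaurent δ ≠ 0 := fun h => hδ0 (toLaurent_injective (by simpa [toLaurent] using h))
  have hB0 : Polynomial.aeval (toLaurent (PowerSeries.X * Z)) B ≠ 0 := by
    intro h
    rw [h, div_zero] at hAB
    exact hd0 hAB
  have hB : B ≠ 0 := by
    rintro rfl
    simp at hB0
  rw [eq_div_iff hB0, aeval_toLaurent, aeval_toLaurent] at hAB
  have hAB' : δ * Polynomial.aeval (PowerSeries.X * Z) B = Polynomial.aeval (PowerSeries.X * Z) A := by
    apply toLaurent_injective
    rw [← hAB]
    simp only [toLaurent, map_mul]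
  -- `D` is `1 - pZ(1 + Z) + p²Z²` after the substitution `Z = 1 + c s³`.
  set D : Polynomial ℝ := Polynomial.C (c ^ 2 * (p ^ 2 - p)) * Polynomial.X ^ 6
    + Polynomial.C (c * (2 * p ^ 2 - 3 * p)) * Polynomial.X ^ 3 + Polynomial.C ((1 - p) ^ 2) with hD
  have ha : c ^ 2 * (p ^ 2 - p) < 0 :=
    mul_neg_of_pos_of_neg (by positivity) (by nlinarith)
  have hDdeg : D.natDegree = 6 := by
    rw [hD]
    compute_degree!
    simpa using ha.ne
  have hDlead : D.leadingCoeff = c ^ 2 * (p ^ 2 - p) := by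
    rw [Polynomial.leadingCoeff, hDdeg, hD]
    simp only [Polynomial.coeff_add, Polynomial.coeff_C_mul, Polynomial.coeff_X_pow,
      Polynomial.coeff_C]
    norm_num
  have hDeval : Polynomial.aeval (PowerSeries.X * Z) D = δ ^ 2 := by
    rw [hδ, hD]
    simp only [map_add, map_mul, map_pow, Polynomial.aeval_C, Polynomial.aeval_X,
      PowerSeries.algebraMap_apply, Algebra.algebraMap_self, RingHom.id_apply, map_sub, map_one,
      map_ofNat]
    set P := PowerSeries.C p
    set c' := PowerSeries.C c
    have hs : c' * (PowerSeries.X * Z) ^ 3 = Z - 1 := by linear_combination -hZ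
    linear_combination ((P ^ 2 - P) * (c' * (PowerSeries.X * Z) ^ 3 + (Z - 1))
      + (2 * P ^ 2 - 3 * P)) * hs
  -- As `s` is transcendental over `ℝ`, `δ = A(s) / B(s)` gives a polynomial identity `B² D = A²`,
  -- whose leading coefficients have opposite signs.
  have hzero : B ^ 2 * D - A ^ 2 = 0 := by
    apply aeval_ne_zero_of_X_mul (Z := Z) (by rw [hZ1]; exact one_ne_zero) _ _ le_rfl
    rw [map_sub, map_mul, map_pow, map_pow, hDeval, ← hAB']
    ring
  have hlead := congrArg Polynomial.leadingCoeff (sub_eq_zero.mp hzero)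
  rw [Polynomial.leadingCoeff_mul, Polynomial.leadingCoeff_pow, Polynomial.leadingCoeff_pow,
    hDlead] at hlead
  have hBl : 0 < B.leadingCoeff ^ 2 := by
    have := Polynomial.leadingCoeff_ne_zero.mpr hB
    positivity
  nlinarith [sq_nonneg A.leadingCoeff, mul_neg_of_pos_of_neg hBl ha]

/-- The series `Z` is cubic over `ℝ(t)`. -/
theorem natDegree_minpoly_cubic {Z : PowerSeries ℝ} {c : ℝ} (hc : c ≠ 0)
    (hZ : Z = 1 + PowerSeries.C c * PowerSeries.X ^ 3 * Z ^ 3) :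
    (minpoly (RatFunc ℝ) (toLaurent Z)).natDegree = 3 := by
  set f : Polynomial (RatFunc ℝ) := Polynomial.C (RatFunc.C c * RatFunc.X ^ 3) * Polynomial.X ^ 3
    - Polynomial.X + 1 with hf
  have hlead : RatFunc.C c * RatFunc.X ^ 3 ≠ 0 := by
    apply mul_ne_zero _ (pow_ne_zero 3 RatFunc.X_ne_zero)
    simpa using hc
  have hdeg : f.natDegree = 3 := by
    rw [hf]
    compute_degree!
    exact ⟨hc, RatFunc.X_ne_zero⟩
  have hirr : Irreducible f := by
    rw [Polynomial.irreducible_iff_roots_eq_zero_of_degree_le_three (by omega) (by omega),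
      Multiset.eq_zero_iff_forall_notMem]
    intro x hx
    apply RatFunc.cubic_no_root hc x
    have := (Polynomial.mem_roots'.mp hx).2
    simpa [hf, Polynomial.IsRoot] using this
  have hroot : Polynomial.aeval (toLaurent Z) f = 0 := by
    have h := congrArg toLaurent hZ
    rw [hf]
    simp only [map_add, map_sub, map_mul, map_pow, map_one, Polynomial.aeval_C, Polynomial.aeval_X,
      algebraMap_C_laurent, algebraMap_X_laurent]
    simp only [toLaurent, map_add, map_one, map_mul, map_pow] at h ⊢
    linear_combination -h
  rw [← minpoly.eq_of_irreducible hirr hroot, Polynomial.natDegree_mul_C, hdeg]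
  simpa using hirr.ne_zero

namespace QuadrantWalk

variable (w : QuadrantWalk)

theorem isZ_iff (hpq : w.p = w.q) {Z : PowerSeries ℝ} (hZ : w.IsZ Z) :
    Z = 1 + PowerSeries.C (4 * w.p * w.p * w.r) * PowerSeries.X ^ 3 * Z ^ 3 := by
  have h := hZ
  unfold IsZ at h
  rwa [← hpq] at h

open IntermediateField in
theorem natDegree_minpoly_P00 (hα : w.p / w.r = w.p₁ / w.r₁) (hβ : w.q / w.r = w.q₂ / w.r₂)
    (hpq : w.p = w.q) : (minpoly (RatFunc ℝ) (toLaurent w.P00)).natDegree = 6 := by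
  obtain ⟨Z, hZ, -⟩ := w.existsUnique_isZ
  obtain ⟨δ, hδ⟩ := w.exists_sqrt_deltaMinusP hpq hZ
  have hc : 4 * w.p * w.p * w.r ≠ 0 := by
    have := w.p_pos
    have := w.r_pos
    positivity
  have hp := w.p_lt_half hpq
  have hp0 := w.p_pos
  have hZ1 := w.constantCoeff_of_isZ hZ
  have hZ' := w.isZ_iff hpq hZ
  have hγ := w.P00_add_mul hα hβ hpq hZ hδ
  set κ := w.r / w.p
  have hκ : κ ≠ 0 := (div_pos w.r_pos hp0).ne'
  set γ := w.P00 + PowerSeries.C κ with hγdef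
  have h3 := natDegree_minpoly_cubic hc hZ'
  have hδ0 : δ ≠ 0 := by
    rintro rfl
    have := hδ.2
    simp at this
  have hδF := not_mem_of_sq_eq hc hp0 (by linarith) hZ1 hZ' hδ0 hδ.1
  set F := (RatFunc ℝ)⟮toLaurent Z⟯ with hF
  have hzF : toLaurent Z ∈ F := mem_adjoin_simple_self _ _
  have hCF : ∀ a, toLaurent (PowerSeries.C a) ∈ F := fun a => by
    rw [← algebraMap_C_laurent]
    exact F.algebraMap_mem _
  have hU0 : toLaurent (1 - PowerSeries.C (2 * w.p) * Z) ≠ 0 := by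
    intro h
    have h' : 1 - PowerSeries.C (2 * w.p) * Z = 0 :=
      toLaurent_injective (by simpa only [toLaurent, map_zero] using h)
    have := congrArg PowerSeries.constantCoeff h'
    simp only [map_sub, map_mul, map_one, PowerSeries.constantCoeff_C, hZ1, map_zero] at this
    linarith
  have hUF : toLaurent (1 - PowerSeries.C (2 * w.p) * Z) ∈ F := by
    simp only [toLaurent, map_sub, map_mul, map_one] at hzF hCF ⊢
    exact sub_mem (one_mem _) (mul_mem (mul_mem (hCF 2) (hCF w.p)) hzF)
  have hγL : toLaurent γ * toLaurent (1 - PowerSeries.C (2 * w.p) * Z)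
      = toLaurent (PowerSeries.C κ) * toLaurent δ := by
    simp only [toLaurent, ← map_mul, hγ]
  have hδL : toLaurent δ ^ 2 = 1 - toLaurent (PowerSeries.C w.p) * toLaurent Z * (1 + toLaurent Z)
      + toLaurent (PowerSeries.C w.p) ^ 2 * toLaurent Z ^ 2 := by
    have := congrArg toLaurent hδ.1
    simpa only [deltaMinusP, toLaurent, map_pow, map_add, map_sub, map_mul, map_one] using this
  have hκL : toLaurent (PowerSeries.C κ) ≠ 0 := by
    intro h
    have : PowerSeries.C κ = 0 :=
      toLaurent_injective (by simpa only [toLaurent, map_zero] using h)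
    exact hκ (by simpa using congrArg PowerSeries.constantCoeff this)
  have key : (minpoly (RatFunc ℝ) (toLaurent γ)).natDegree = 6 := by
    apply natDegree_minpoly_eq_six h3
    · rw [← hF]
      have : toLaurent γ ^ 2 = (toLaurent (PowerSeries.C κ) ^ 2 * toLaurent δ ^ 2)
          / toLaurent (1 - PowerSeries.C (2 * w.p) * Z) ^ 2 := by
        rw [eq_div_iff (pow_ne_zero 2 hU0), ← mul_pow, hγL, mul_pow]
      rw [this, hδL]
      refine div_mem (mul_mem (pow_mem (hCF _) 2) (add_mem (sub_mem (one_mem _) ?_) ?_))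
        (pow_mem hUF 2)
      · exact mul_mem (mul_mem (hCF _) hzF) (add_mem (one_mem _) hzF)
      · exact mul_mem (pow_mem (hCF _) 2) (pow_mem hzF 2)
    · intro h
      apply hδF
      have : toLaurent δ = toLaurent γ * toLaurent (1 - PowerSeries.C (2 * w.p) * Z)
          / toLaurent (PowerSeries.C κ) := by
        rw [hγL, mul_div_cancel_left₀ _ hκL]
      rw [this]
      exact div_mem (mul_mem h hUF) (hCF κ)
    · rintro ⟨k, hk⟩
      have hk' : algebraMap (RatFunc ℝ) (LaurentSeries ℝ) k = toLaurent γ ^ 2 := hk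
      set P : RatFunc ℝ := RatFunc.C w.p
      set κ' : RatFunc ℝ := RatFunc.C κ
      have hP : P ≠ 0 := by simpa [P] using hp0.ne'
      have hκ' : κ' ≠ 0 := by simpa [κ'] using hκ
      -- If `γ² = k` were in `ℝ(t)`, then `k (1 - 2pZ)² = κ² (1 - pZ(1 + Z) + p²Z²)` would be a
      -- quadratic equation for the cubic `Z`.
      set f : Polynomial (RatFunc ℝ) :=
        Polynomial.C (4 * P ^ 2 * k - κ' ^ 2 * (P ^ 2 - P)) * Polynomial.X ^ 2
        + Polynomial.C (κ' ^ 2 * P - 4 * P * k) * Polynomial.X + Polynomial.C (k - κ' ^ 2) with hf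
      have hroot : Polynomial.aeval (toLaurent Z) f = 0 := by
        rw [hf]
        simp only [map_add, map_sub, map_mul, map_pow, Polynomial.aeval_C, Polynomial.aeval_X, hk',
          P, κ', algebraMap_C_laurent, map_ofNat]
        have h2 : toLaurent (1 - PowerSeries.C (2 * w.p) * Z)
            = 1 - 2 * toLaurent (PowerSeries.C w.p) * toLaurent Z := by
          simp only [toLaurent, map_sub, map_mul, map_one, map_ofNat]
        rw [h2] at hγL
        linear_combination (toLaurent γ * (1 - 2 * toLaurent (PowerSeries.C w.p) * toLaurent Z)
          + toLaurent (PowerSeries.C κ) * toLaurent δ) * hγL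
          + toLaurent (PowerSeries.C κ) ^ 2 * hδL
      -- A zero constant coefficient means `k = κ²`, and then the linear one is `-3pκ² ≠ 0`.
      have hf0 : f ≠ 0 := by
        intro h
        have e₀ := congrArg (fun g => Polynomial.coeff g 0) h
        have e₁ := congrArg (fun g => Polynomial.coeff g 1) h
        simp only [hf, Polynomial.coeff_add, Polynomial.coeff_C_mul, Polynomial.coeff_X_pow,
          Polynomial.coeff_X, Polynomial.coeff_C, Polynomial.coeff_zero] at e₀ e₁
        norm_num at e₀ e₁
        have : (3 : RatFunc ℝ) * (P * κ' ^ 2) = 0 := by linear_combination -4 * P * e₀ - e₁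
        exact mul_ne_zero three_ne_zero (mul_ne_zero hP (pow_ne_zero 2 hκ')) this
      have hle := Polynomial.natDegree_le_of_dvd (minpoly.dvd _ _ hroot) hf0
      have hdeg : f.natDegree ≤ 2 := by
        rw [hf]
        compute_degree
      omega
  have hsub : toLaurent w.P00 = toLaurent γ
      - algebraMap (RatFunc ℝ) (LaurentSeries ℝ) (RatFunc.C κ) := by
    rw [algebraMap_C_laurent, hγdef]
    simp only [toLaurent, map_add, add_sub_cancel_right]
  rw [hsub, minpoly.sub_algebraMap, Polynomial.natDegree_comp, Polynomial.natDegree_X_add_C,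
    mul_one, key]

theorem isAlgebraic_P00 (hα : w.p / w.r = w.p₁ / w.r₁) (hβ : w.q / w.r = w.q₂ / w.r₂)
    (hpq : w.p = w.q) : IsAlgebraic (RatFunc ℝ) (toLaurent w.P00) := by
  have h := w.natDegree_minpoly_P00 hα hβ hpq
  rw [isAlgebraic_iff_isIntegral]
  by_contra h'
  rw [minpoly.eq_zero h', Polynomial.natDegree_zero] at h
  omega

end QuadrantWalk

/-! ### Algebraicity of the trivariate series -/

/-- The algebraic series in `x, y, t`. -/
noncomputable abbrev algebraicSeries : Subalgebra (MvPolynomial (Fin 3) ℝ) (MvPowerSeries (Fin 3) ℝ) :=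
  Subalgebra.algebraicClosure _ _

theorem mem_algebraicSeries_of_mul {f g : MvPowerSeries (Fin 3) ℝ} (hf0 : f ≠ 0)
    (hf : f ∈ algebraicSeries) (hfg : f * g ∈ algebraicSeries) : g ∈ algebraicSeries :=
  IsAlgebraic.of_mul (mem_nonZeroDivisors_of_ne_zero hf0) hf hfg

theorem mem_algebraicSeries_of_sq {f : MvPowerSeries (Fin 3) ℝ}
    (hf : f ^ 2 ∈ algebraicSeries) : f ∈ algebraicSeries :=
  IsAlgebraic.of_pow two_pos hf

theorem algebraMap_mvPolynomial_C (c : ℝ) : algebraMap (MvPolynomial (Fin 3) ℝ)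
    (MvPowerSeries (Fin 3) ℝ) (MvPolynomial.C c) = const3 c := by
  simp [MvPowerSeries.algebraMap_apply']

theorem algebraMap_mvPolynomial_X (s : Fin 3) : algebraMap (MvPolynomial (Fin 3) ℝ)
    (MvPowerSeries (Fin 3) ℝ) (MvPolynomial.X s) = MvPowerSeries.X s := by
  simp [MvPowerSeries.algebraMap_apply']

theorem const3_mem (c : ℝ) : const3 c ∈ algebraicSeries := by
  rw [← algebraMap_mvPolynomial_C]
  exact isAlgebraic_algebraMap _

theorem X_mem_algebraicSeries (s : Fin 3) : MvPowerSeries.X s ∈ algebraicSeries := by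
  rw [← algebraMap_mvPolynomial_X]
  exact isAlgebraic_algebraMap _

theorem inT_add (f g : PowerSeries ℝ) : inT (f + g) = inT f + inT g := by
  simp only [← inTHom_apply, map_add]

theorem inT_sub (f g : PowerSeries ℝ) : inT (f - g) = inT f - inT g := by
  simp only [← inTHom_apply, map_sub]

theorem inT_mul (f g : PowerSeries ℝ) : inT (f * g) = inT f * inT g := by
  simp only [← inTHom_apply, map_mul]

theorem inT_pow (f : PowerSeries ℝ) (n : ℕ) : inT (f ^ n) = inT f ^ n := by
  simp only [← inTHom_apply, map_pow]

theorem inT_one : inT 1 = 1 := by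
  rw [← inTHom_apply, map_one]

theorem mvPowerSeries_X_ne_zero (s : Fin 3) : (MvPowerSeries.X s : MvPowerSeries (Fin 3) ℝ) ≠ 0 := by
  intro h
  simpa using congrArg (MvPowerSeries.coeff (Finsupp.single s 1)) h

theorem two_ne_zero_mvPowerSeries : (2 : MvPowerSeries (Fin 3) ℝ) ≠ 0 := by
  intro h
  have h' := congrArg MvPowerSeries.constantCoeff h
  rw [map_ofNat, map_zero] at h'
  norm_num at h'

theorem inT_ne_zero {f : PowerSeries ℝ} (hf : PowerSeries.constantCoeff f ≠ 0) : inT f ≠ 0 := by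
  intro h
  apply hf
  rw [← constantCoeff_inT, h, map_zero]

/-- A series is algebraic when it is so after scaling of `x` and `y`. -/
theorem mem_algebraicSeries_of_scaled {p : ℝ} (hp : p ≠ 0) {f : MvPowerSeries (Fin 3) ℝ}
    (hf : evalXY f (const3 p * xVar) (const3 p * yVar) ∈ algebraicSeries) :
    f ∈ algebraicSeries := by
  set g := substHom (const3 p⁻¹ * xVar) (const3 p⁻¹ * yVar) tVar (constantCoeff_const3_mul_X _ _)
    (constantCoeff_const3_mul_X _ _) (MvPowerSeries.constantCoeff_X 2)
  have hgf : g (evalXY f (const3 p * xVar) (const3 p * yVar)) = f := by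
    rw [evalXY_eq_substHom _ (constantCoeff_const3_mul_X _ _) (constantCoeff_const3_mul_X _ _),
      substHom_substHom, substHom_eq]
    have : ∀ a : MvPowerSeries (Fin 3) ℝ, const3 p * (const3 p⁻¹ * a) = a := by
      intro a
      rw [← mul_assoc, const3, const3, ← map_mul, mul_inv_cancel₀ hp, map_one, one_mul]
    simp only [map_mul, substHom_const3, substHom_xVar, substHom_yVar, substHom_tVar]
    rw [this, this]
    refine Eq.trans ?_ (congrFun (MvPowerSeries.subst_self (σ := Fin 3) (R := ℝ)) f)
    congr 1
    funext s
    fin_cases s <;> rfl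
  let h (c : ℝ) : MvPolynomial (Fin 3) ℝ →ₐ[ℝ] MvPolynomial (Fin 3) ℝ := MvPolynomial.aeval
    ![MvPolynomial.C c * MvPolynomial.X 0, MvPolynomial.C c * MvPolynomial.X 1, MvPolynomial.X 2]
  have hinj : Function.Injective (h p⁻¹) := by
    have hcomp : (h p).comp (h p⁻¹) = AlgHom.id ℝ _ := by
      apply MvPolynomial.algHom_ext
      intro s
      have hC : ∀ a : MvPolynomial (Fin 3) ℝ, MvPolynomial.C p⁻¹ * (MvPolynomial.C p * a) = a := by
        intro a
        rw [← mul_assoc, ← map_mul, inv_mul_cancel₀ hp, map_one, one_mul]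
      fin_cases s <;> simp [h, MvPolynomial.algHom_C, hC]
    exact Function.LeftInverse.injective (g := h p) fun a => DFunLike.congr_fun hcomp a
  -- The inverse scaling `g` restricts to the injective map `h p⁻¹` on polynomials, so it carries an
  -- algebraic equation to a nonzero one.
  rw [← hgf]
  refine IsAlgebraic.ringHom_of_comp_eq (h p⁻¹).toRingHom g hf hinj ?_
  apply MvPolynomial.ringHom_ext
  · intro c
    simp only [AlgHom.toRingHom_eq_coe, RingHom.comp_apply, RingHom.coe_coe]
    rw [algebraMap_mvPolynomial_C, show MvPolynomial.C c = algebraMap ℝ _ c from rfl,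
      AlgHom.commutes]
    exact (algebraMap_mvPolynomial_C c).trans (substHom_const3 _ _ _ c).symm
  · intro s
    simp only [AlgHom.toRingHom_eq_coe, RingHom.comp_apply, RingHom.coe_coe]
    rw [algebraMap_mvPolynomial_X]
    fin_cases s
    · refine Eq.trans ?_ (substHom_xVar _ _ _).symm
      simp [h, algebraMap_mvPolynomial_C, algebraMap_mvPolynomial_X, map_mul]
    · refine Eq.trans ?_ (substHom_yVar _ _ _).symm
      simp [h, algebraMap_mvPolynomial_C, algebraMap_mvPolynomial_X, map_mul]
    · refine Eq.trans ?_ (substHom_tVar _ _ _).symm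
      simp [h, algebraMap_mvPolynomial_X]

namespace QuadrantWalk

variable (w : QuadrantWalk)

theorem inT_Z_mem {Z : PowerSeries ℝ} (hZ : w.IsZ Z) : inT Z ∈ algebraicSeries := by
  refine ⟨Polynomial.C (MvPolynomial.C (4 * w.p * w.q * w.r) * MvPolynomial.X 2 ^ 3)
    * Polynomial.X ^ 3 - Polynomial.X + 1, ?_, ?_⟩
  · intro h
    have := congrArg (fun f => Polynomial.coeff f 0) h
    simp at this
  · have h := congrArg inTHom hZ
    simp only [map_add, map_one, map_mul, map_pow, inTHom_apply, inT_X, inT_C] at h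
    simp only [map_add, map_sub, map_mul, map_pow, map_one, Polynomial.aeval_C, Polynomial.aeval_X,
      algebraMap_mvPolynomial_C, algebraMap_mvPolynomial_X]
    linear_combination -h

theorem inT_P00_mem (hα : w.p / w.r = w.p₁ / w.r₁) (hβ : w.q / w.r = w.q₂ / w.r₂)
    (hpq : w.p = w.q) : inT w.P00 ∈ algebraicSeries := by
  obtain ⟨Z, hZ, -⟩ := w.existsUnique_isZ
  obtain ⟨δ, hδ⟩ := w.exists_sqrt_deltaMinusP hpq hZ
  have hzm := w.inT_Z_mem hZ
  have hδm : inT δ ∈ algebraicSeries := by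
    apply mem_algebraicSeries_of_sq
    rw [← inT_pow, hδ.1, deltaMinusP]
    simp only [inT_add, inT_sub, inT_mul, inT_pow, inT_one, inT_C]
    exact add_mem (sub_mem (one_mem _) (mul_mem (mul_mem (const3_mem _) hzm)
      (add_mem (one_mem _) hzm))) (mul_mem (const3_mem _) (pow_mem hzm 2))
  have hγ := congrArg inT (w.P00_add_mul hα hβ hpq hZ hδ)
  rw [mul_comm] at hγ
  simp only [inT_mul, inT_sub, inT_add, inT_one, inT_C] at hγ
  have hsum : inT w.P00 + const3 (w.r / w.p) ∈ algebraicSeries := by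
    refine mem_algebraicSeries_of_mul (f := 1 - const3 (2 * w.p) * inT Z) ?_
      (sub_mem (one_mem _) (mul_mem (const3_mem _) hzm)) ?_
    · intro h
      have := congrArg MvPowerSeries.constantCoeff h
      rw [map_sub, map_mul, map_one, constantCoeff_inT, w.constantCoeff_of_isZ hZ,
        MvPowerSeries.constantCoeff_C, map_zero] at this
      linarith [w.p_lt_half hpq]
    · rw [hγ]
      exact mul_mem (const3_mem _) hδm
  simpa using sub_mem hsum (const3_mem (w.r / w.p))

/-- The series `Q(pv, 0)`, for a variable `v`, is algebraic. -/
theorem substHom_Qpx_mem (hα : w.p / w.r = w.p₁ / w.r₁) (hβ : w.q / w.r = w.q₂ / w.r₂)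
    (hpq : w.p = w.q) (s : Fin 3) (hs : s ≠ 2) :
    substHom (MvPowerSeries.X s) 0 tVar (MvPowerSeries.constantCoeff_X s) (map_zero _)
      (MvPowerSeries.constantCoeff_X 2) w.Qpx ∈ algebraicSeries := by
  obtain ⟨Z, hZ, -⟩ := w.existsUnique_isZ
  set φ := substHom (MvPowerSeries.X s) 0 tVar (MvPowerSeries.constantCoeff_X s) (map_zero _)
      (MvPowerSeries.constantCoeff_X 2)
  have hx : φ xVar = MvPowerSeries.X s := substHom_xVar _ _ _
  have ht : φ tVar = tVar := substHom_tVar _ _ _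
  have hc : ∀ c, φ (const3 c) = const3 c := fun c => substHom_const3 _ _ _ c
  have hi : ∀ f, φ (inT f) = inT f := fun f => substHom_inT _ _ _ f
  have hzm := w.inT_Z_mem hZ
  have hX := X_mem_algebraicSeries s
  have hT : tVar ∈ algebraicSeries := X_mem_algebraicSeries 2
  have h2 : (2 : MvPowerSeries (Fin 3) ℝ) ∈ algebraicSeries := ofNat_mem _ 2
  have hP := w.inT_P00_mem hα hβ hpq
  have hη : φ (w.eta Z) ∈ algebraicSeries := by
    apply mem_algebraicSeries_of_sq
    rw [← map_pow, eta_sq, deltaPlus]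
    simp only [map_sub, map_one, hc, hi, ht, hx, map_mul φ, map_pow φ]
    exact sub_mem (one_mem _) (mul_mem (mul_mem (mul_mem (const3_mem _) (pow_mem hT 2))
      (pow_mem hzm 2)) hX)
  have h := congrArg φ (w.defect_eq_zero hα hβ hpq hZ)
  rw [defect, map_zero, inT_add, inT_C] at h
  simp only [map_sub φ, map_add φ, hc, hi, ht, hx, map_mul φ, map_ofNat] at h
  have hker : φ w.axisKernel ∈ algebraicSeries ∧ φ w.axisKernel ≠ 0 := by
    have heq : φ w.axisKernel = tVar - const3 (1 - w.p) * MvPowerSeries.X s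
        + const3 (w.p * w.r) * MvPowerSeries.X s ^ 2 * tVar ^ 2 := by
      rw [axisKernel]
      simp only [map_sub, map_add, hc, ht, hx, map_mul φ, map_pow φ]
    constructor
    · rw [heq]
      exact add_mem (sub_mem hT (mul_mem (const3_mem _) hX))
        (mul_mem (mul_mem (const3_mem _) (pow_mem hX 2)) (pow_mem hT 2))
    · intro h0
      rw [heq] at h0
      -- Setting the variable to `0` leaves `t`; this needs `s ≠ 2`.
      have h1 := congrArg (substHom 0 0 tVar (map_zero _) (map_zero _)
        (MvPowerSeries.constantCoeff_X 2)) h0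
      have hs0 : substHom 0 0 tVar (map_zero _) (map_zero _) (MvPowerSeries.constantCoeff_X 2)
          (MvPowerSeries.X s : MvPowerSeries (Fin 3) ℝ) = 0 := by
        fin_cases s
        · exact substHom_xVar _ _ _
        · exact substHom_yVar _ _ _
        · exact absurd rfl hs
      rw [map_add, map_sub, map_mul, map_mul, map_mul, map_pow, hs0, substHom_tVar, map_zero] at h1
      have h3 : tVar = 0 := by linear_combination h1
      exact mvPowerSeries_X_ne_zero _ h3
  have hZ0 : inT Z ≠ 0 := inT_ne_zero (by rw [w.constantCoeff_of_isZ hZ]; exact one_ne_zero)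
  apply mem_algebraicSeries_of_mul (mul_ne_zero (mul_ne_zero two_ne_zero_mvPowerSeries hZ0) hker.2)
    (mul_mem (mul_mem h2 hzm) hker.1)
  have heq : 2 * inT Z * φ w.axisKernel * φ w.Qpx
      = 2 * inT Z * (const3 (w.r / (2 * w.p))
          * (const3 (1 - w.p) * MvPowerSeries.X s - 2 * tVar))
        + (inT w.P00 + const3 (w.r / w.p))
          * ((2 * tVar * inT Z - MvPowerSeries.X s) * φ (w.eta Z)) := by
    linear_combination h
  rw [heq]
  refine add_mem (mul_mem (mul_mem h2 hzm) (mul_mem (const3_mem _)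
    (sub_mem (mul_mem (const3_mem _) hX) (mul_mem h2 hT))))
    (mul_mem (add_mem hP (const3_mem _)) (mul_mem (sub_mem (mul_mem (mul_mem h2 hT) hzm) hX) hη))

theorem isAlgebraic_genFun (hα : w.p / w.r = w.p₁ / w.r₁) (hβ : w.q / w.r = w.q₂ / w.r₂)
    (hpq : w.p = w.q) : IsAlgebraic (MvPolynomial (Fin 3) ℝ) w.genFun := by
  have hX : xVar ∈ algebraicSeries := X_mem_algebraicSeries 0
  have hY : yVar ∈ algebraicSeries := X_mem_algebraicSeries 1
  have hT : tVar ∈ algebraicSeries := X_mem_algebraicSeries 2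
  have hP := w.inT_P00_mem hα hβ hpq
  have h₁ : w.Qpx ∈ algebraicSeries := by
    rw [← substHom_Qpx]
    exact w.substHom_Qpx_mem hα hβ hpq 0 (by decide)
  have h₂ : w.Qpy ∈ algebraicSeries := by
    rw [w.Qpy_eq_evalXY hα hβ hpq,
      evalXY_eq_substHom _ (MvPowerSeries.constantCoeff_X 1) (map_zero _)]
    exact w.substHom_Qpx_mem hα hβ hpq 1 (by decide)
  have h₃ : w.Qpxy ∈ algebraicSeries := by
    refine mem_algebraicSeries_of_mul (f := xVar * yVar - tVar * (xVar + yVar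
      + const3 (w.p * w.q * w.r) * xVar ^ 2 * yVar ^ 2)) ?_ ?_ ?_
    · intro h
      -- At `y = 0` the kernel is `-xt`.
      have h' := congrArg (substHom xVar 0 tVar (MvPowerSeries.constantCoeff_X 0) (map_zero _)
        (MvPowerSeries.constantCoeff_X 2)) h
      simp only [map_sub, map_add, map_mul, map_pow, substHom_xVar, substHom_yVar, substHom_tVar,
        map_zero] at h'
      refine mul_ne_zero (mvPowerSeries_X_ne_zero 0) (mvPowerSeries_X_ne_zero 2) ?_
      linear_combination -h'
    · exact sub_mem (mul_mem hX hY) (mul_mem hT (add_mem (add_mem hX hY)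
        (mul_mem (mul_mem (const3_mem _) (pow_mem hX 2)) (pow_mem hY 2))))
    · rw [w.functional_equation_symm hα hβ hpq]
      exact sub_mem (sub_mem (mul_mem (mul_mem (const3_mem _) hX) hY)
        (mul_mem (mul_mem (sub_mem hT (mul_mem (const3_mem _) hY)) hX) h₁))
        (mul_mem (mul_mem (sub_mem hT (mul_mem (const3_mem _) hX)) hY) h₂)
  refine mem_algebraicSeries_of_scaled w.p_pos.ne' ?_
  rw [evalXY_genFun]
  exact add_mem (add_mem (add_mem hP (mul_mem (const3_mem _) (sub_mem h₁ hP)))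
    (mul_mem (const3_mem _) (sub_mem h₂ hP)))
    (mul_mem (const3_mem _) (add_mem (sub_mem (sub_mem h₃ h₁) h₂) hP))

end QuadrantWalk

/-! ### Closed forms and the main theorem -/

/-- The argument `p/t` is only a Laurent series, but each occurrence in `Δ₋` comes with a factor
`t`. -/
theorem toLaurent_deltaMinusP (p : ℝ) (Z : PowerSeries ℝ) :
    toLaurent (1 - PowerSeries.C p * Z * (1 + Z) + PowerSeries.C (p ^ 2) * Z ^ 2)
      = deltaMinus Z (HahnSeries.single (-1) p) := by
  have hX : HahnSeries.ofPowerSeries ℤ ℝ PowerSeries.X * HahnSeries.single (-1) p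
      = HahnSeries.ofPowerSeries ℤ ℝ (PowerSeries.C p) := by
    rw [HahnSeries.ofPowerSeries_X, HahnSeries.single_mul_single, HahnSeries.ofPowerSeries_C,
      HahnSeries.C_apply]
    norm_num
  simp only [deltaMinus, toLaurent, map_add, map_sub, map_mul, map_pow, map_one]
  rw [← hX]
  ring

namespace QuadrantWalk

variable (w : QuadrantWalk)

theorem P00_eq (hα : w.p / w.r = w.p₁ / w.r₁) (hβ : w.q / w.r = w.q₂ / w.r₂)
    (hpq : w.p = w.q) {Z δ : PowerSeries ℝ} (hZ : w.IsZ Z)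
    (hδ : IsSeriesSqrt δ (w.deltaMinusP Z)) :
    w.P00 = PowerSeries.C (w.r / w.p) * (δ * (1 - PowerSeries.C (2 * w.p) * Z)⁻¹ - 1) := by
  have h := w.P00_add_mul hα hβ hpq hZ hδ
  have hinv := PowerSeries.mul_inv_cancel (1 - PowerSeries.C (2 * w.p) * Z) (by
    rw [map_sub, map_mul, map_one, PowerSeries.constantCoeff_C, w.constantCoeff_of_isZ hZ]
    linarith [w.p_lt_half hpq])
  linear_combination (1 - PowerSeries.C (2 * w.p) * Z)⁻¹ * h
    - (w.P00 + PowerSeries.C (w.r / w.p)) * hinv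

theorem axisKernel_mul_Qpx (hα : w.p / w.r = w.p₁ / w.r₁) (hβ : w.q / w.r = w.q₂ / w.r₂)
    (hpq : w.p = w.q) {Z δ : PowerSeries ℝ} (hZ : w.IsZ Z)
    (hδ : IsSeriesSqrt δ (w.deltaMinusP Z)) :
    w.axisKernel * w.Qpx = const3 (w.r / (2 * w.p)) *
      ((2 * tVar * inT Z - xVar) * inT δ * w.eta Z *
          (inT Z * (1 - const3 (2 * w.p) * inT Z))⁻¹
        - 2 * tVar + const3 (1 - w.p) * xVar) := by
  have h := w.defect_eq_zero hα hβ hpq hZ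
  rw [defect, inT_add, inT_C] at h
  have hγ := congrArg inT (w.P00_add_mul hα hβ hpq hZ hδ)
  simp only [inT_mul, inT_sub, inT_add, inT_one, inT_C] at hγ
  have hcc : MvPowerSeries.constantCoeff (inT Z * (1 - const3 (2 * w.p) * inT Z)) ≠ 0 := by
    rw [map_mul, map_sub, map_mul, map_one, MvPowerSeries.constantCoeff_C, constantCoeff_inT,
      w.constantCoeff_of_isZ hZ]
    linarith [w.p_lt_half hpq]
  have hinv := MvPowerSeries.mul_inv_cancel _ hcc
  set D := (inT Z * (1 - const3 (2 * w.p) * inT Z)) with hD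
  have hD0 : D ≠ 0 := by
    intro h0
    rw [h0, map_zero] at hcc
    exact hcc rfl
  have hk : const3 (w.r / w.p) = 2 * const3 (w.r / (2 * w.p)) := by
    rw [const3, const3, ← map_ofNat (MvPowerSeries.C (R := ℝ)) 2, ← map_mul]
    congr 1
    have := w.p_pos.ne'
    field_simp
  apply mul_left_cancel₀ (mul_ne_zero two_ne_zero_mvPowerSeries hD0)
  rw [hk] at h hγ
  -- The vanishing defect is multiplied by `1 - 2pZ`, and `(P₀₀ + r/p)(1 - 2pZ)` is replaced by
  -- `(r/p) δ`.
  linear_combination (1 - const3 (2 * w.p) * inT Z) * h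
    + ((2 * tVar * inT Z - xVar) * w.eta Z) * hγ
    - 2 * const3 (w.r / (2 * w.p)) * ((2 * tVar * inT Z - xVar) * inT δ * w.eta Z) * hinv
    + 2 * (w.axisKernel * w.Qpx - const3 (w.r / (2 * w.p)) * (const3 (1 - w.p) * xVar - 2 * tVar)) * hD

end QuadrantWalk

theorem mainTheorem7 (w : QuadrantWalk)
    (hα : w.p / w.r = w.p₁ / w.r₁) (hβ : w.q / w.r = w.q₂ / w.r₂) (hpq : w.p = w.q) :
    -- the trivariate generating function is algebraic
    IsAlgebraic (MvPolynomial (Fin 3) ℝ) w.genFun ∧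
    -- only multiples of `3` contribute to `P_{0,0}`, which is algebraic of degree `6` over `ℝ(t)`
    (∀ n : ℕ, ¬ 3 ∣ n → w.law n (0, 0) = 0) ∧
    IsAlgebraic (RatFunc ℝ) (toLaurent w.P00) ∧
    (minpoly (RatFunc ℝ) (toLaurent w.P00)).natDegree = 6 ∧
    -- explicit expressions in terms of the unique series `Z`
    (∃! Z : PowerSeries ℝ, w.IsZ Z) ∧
    ∀ Z : PowerSeries ℝ, w.IsZ Z →
      -- `δ = √Δ₋(p/t)` and `η = √Δ₊(x)`
      ∃ (δ : PowerSeries ℝ) (η : MvPowerSeries (Fin 3) ℝ),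
        IsSeriesSqrt δ
          (1 - PowerSeries.C w.p * Z * (1 + Z) + PowerSeries.C (w.p ^ 2) * Z ^ 2) ∧
        toLaurent
            (1 - PowerSeries.C w.p * Z * (1 + Z) + PowerSeries.C (w.p ^ 2) * Z ^ 2)
          = deltaMinus Z (HahnSeries.single (-1) w.p) ∧
        IsSeriesSqrt η (w.deltaPlus Z) ∧
        -- the expression of `P_{0,0}`
        w.P00 = PowerSeries.C (w.r / w.p) *
          (δ * (1 - PowerSeries.C (2 * w.p) * Z)⁻¹ - 1) ∧
        -- the expression of `Q(px, 0)`
        evalXY w.Q (const3 w.p * xVar) 0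
          = inT w.P00 + const3 w.r₁ * evalXY w.P1 (const3 w.p * xVar) 0 ∧
        (tVar - const3 (1 - w.p) * xVar + const3 (w.p * w.r) * xVar ^ 2 * tVar ^ 2) *
            evalXY w.Q (const3 w.p * xVar) 0
          = const3 (w.r / (2 * w.p)) *
            ((2 * tVar * inT Z - xVar) * inT δ * η *
                (inT Z * (1 - const3 (2 * w.p) * inT Z))⁻¹
              - 2 * tVar + const3 (1 - w.p) * xVar) ∧
        -- setting `x = 0` in `Q(px, 0)` gives `P_{0,0}`
        evalXY (evalXY w.Q (const3 w.p * xVar) 0) 0 0 = inT w.P00 ∧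
        -- the expressions of `Q(0, py)`, of `Q(px, py)` and of the trivariate series
        evalXY w.Q 0 (const3 w.p * yVar)
          = evalXY (evalXY w.Q (const3 w.p * xVar) 0) yVar 0 ∧
        (xVar * yVar - tVar * (xVar + yVar + const3 (w.p * w.q * w.r) * xVar ^ 2 * yVar ^ 2)) *
            evalXY w.Q (const3 w.p * xVar) (const3 w.p * yVar)
          = const3 w.r * xVar * yVar
            - (tVar - const3 w.p * yVar) * xVar * evalXY w.Q (const3 w.p * xVar) 0
            - (tVar - const3 w.p * xVar) * yVar * evalXY w.Q 0 (const3 w.p * yVar) ∧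
        evalXY w.genFun (const3 w.p * xVar) (const3 w.p * yVar)
          = inT w.P00
            + const3 (1 / w.r₁) * (evalXY w.Q (const3 w.p * xVar) 0 - inT w.P00)
            + const3 (1 / w.r₂) * (evalXY w.Q 0 (const3 w.p * yVar) - inT w.P00)
            + const3 (1 / w.r) *
              (evalXY w.Q (const3 w.p * xVar) (const3 w.p * yVar)
                - evalXY w.Q (const3 w.p * xVar) 0 - evalXY w.Q 0 (const3 w.p * yVar)
                + inT w.P00) := by
  refine ⟨w.isAlgebraic_genFun hα hβ hpq, fun n hn => w.law_eq_zero n 0 0 (by simpa using hn),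
    w.isAlgebraic_P00 hα hβ hpq, w.natDegree_minpoly_P00 hα hβ hpq, w.existsUnique_isZ,
    fun Z hZ => ?_⟩
  obtain ⟨δ, hδ⟩ := w.exists_sqrt_deltaMinusP hpq hZ
  refine ⟨δ, w.eta Z, hδ, toLaurent_deltaMinusP _ _,
    ⟨w.eta_sq Z, by rw [w.constantCoeff_eta]; exact one_pos⟩, w.P00_eq hα hβ hpq hZ hδ, ?_⟩
  rw [w.evalXY_Q_px_zero, w.evalXY_Q_zero_py, w.evalXY_Q_px_py]
  exact ⟨w.Qpx_eq, w.axisKernel_mul_Qpx hα hβ hpq hZ hδ, w.evalXY_Qpx_zero,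
    w.Qpy_eq_evalXY hα hβ hpq, w.functional_equation_symm hα hβ hpq, w.evalXY_genFun⟩
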